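/- Let $\mathbb{K}=\mathbb{R}$ or $\mathbb{C}$, and let $C^\infty(S^1)$ be the algebra of smooth $\mathbb{K}$-valued functions on $S^1=\mathbb{R}/2\pi\mathbb{Z}$, with coordinate $x$. Let $\mathrm{Vect}(S^1)=\{f\partial : f\in C^\infty(S^1)\}$, $\partial=d/dx$, with bracket $[f\partial,g\partial]=(fg'-f'g)\partial$. Let $\Psi\mathrm{D}(S^1)$ be the associative algebra of pseudodifferential symbols, i.e. formal series $F(x,\xi)=\sum_{k\in\mathbb{Z}}f_k(x)\xi^k$ with $f_k\in C^\infty(S^1)$ and $f_k=0$ for all sufficiently large $k$, with the product $$F\circ G=\sum_{n\ge 0}\frac{1}{n!}\,{:}\,\partial_\xi^nF\;\partial_x^nG\,{:}\,,\qquad {:}f\xi^k\,g\xi^\ell{:}=fg\,\xi^{k+\ell},$$ regarded as a Lie algebra for the commutator, and as a $\mathrm{Vect}(S^1)$-module through the standard embedding $\pi(f\partial)=f\xi$, that is, $f\partial\cdot F=[f\xi,F]$. Let $\mathrm{H}^1(\mathrm{Vect}(S^1);\Psi\mathrm{D}(S^1))$ be the quotient of the space of $1$-cocycles ($\mathbb{K}$-linear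 maps $c:\mathrm{Vect}(S^1)\to\Psi\mathrm{D}(S^1)$ with $c([X,Y])=X\cdot c(Y)-Y\cdot c(X)$) by the space of $1$-coboundaries $X\mapsto X\cdot F$, $F\in\Psi\mathrm{D}(S^1)$. Define linear maps $\mathrm{Vect}(S^1)\to\Psi\mathrm{D}(S^1)$ by $$\theta_0(f\partial)=f,\qquad \theta_1(f\partial)=f',$$ $$\theta_2(f\partial)=\sum_{n=2}^{\infty}(-1)^{n-1}\frac{2(n-3)}{n}f^{(n)}\xi^{-n+1},\qquad \theta_3(f\partial)=\sum_{n=2}^{\infty}(-1)^{n}\frac{3(n-1)}{n+1}f^{(n+1)}\xi^{-n}.$$ Then $\theta_0,\theta_1,\theta_2,\theta_3$ are $1$-cocycles, the vector space $\mathrm{H}^1(\mathrm{Vect}(S^1);\Psi\mathrm{D}(S^1))$ over $\mathbb{K}$ has dimension four, and it is spanned by the classes of $\theta_0,\theta_1,\theta_2,\theta_3$. Moreover, the highest-order terms in $\xi$ of $\theta_2(f\partial)$ and $\theta_3(f\partial)$ are $f''\xi^{-1}$ and $f'''\xi^{-2}$ respectively: the coefficients of all higher powers of $\xi$ vanish.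 -/

import Mathlib

open scoped ContDiff

noncomputable section

namespace PseudoDiff

/-! ### Smooth functions on the circle `S¹ = ℝ / 2πℤ` -/

/-- `C^∞(S¹)`, with values in `𝕜` (the real or the complex numbers): the algebra of smooth
`2π`-periodic functions of the coordinate `x`, with pointwise operations. -/
def smoothCircle (𝕜 : Type*) [RCLike 𝕜] : Subalgebra 𝕜 (ℝ → 𝕜) where
  carrier := {f | ContDiff ℝ ∞ f ∧ Function.Periodic f (2 * Real.pi)}
  mul_mem' hf hg := ⟨hf.1.mul hg.1, hf.2.mul hg.2⟩
  add_mem' hf hg := ⟨hf.1.add hg.1, hf.2.add hg.2⟩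
  algebraMap_mem' _ := ⟨contDiff_const, fun _ => rfl⟩

/-- The derivation `d/dx` of `C^∞(S¹)`. -/
def ddx (𝕜 : Type*) [RCLike 𝕜] : Derivation 𝕜 (smoothCircle 𝕜) (smoothCircle 𝕜) :=
  Derivation.mk'
    { toFun := fun f => ⟨deriv f.1, (contDiff_infty_iff_deriv.1 f.2.1).2, fun x => by
        rw [← deriv_comp_add_const, funext f.2.2]⟩
      map_add' := fun f g => by
        ext x
        exact deriv_add (f.2.1.differentiable (by simp) x) (g.2.1.differentiable (by simp) x)
      map_smul' := fun c f => by
        ext x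
        exact deriv_const_mul c (f.2.1.differentiable (by simp) x) }
    (fun f g => by
      ext x
      have h := deriv_mul (f.2.1.differentiable (by simp) x) (g.2.1.differentiable (by simp) x)
      refine h.trans ?_
      change _ = f.1 x * deriv g.1 x + g.1 x * deriv f.1 x
      ring)

theorem ddx_apply {𝕜 : Type*} [RCLike 𝕜] (f : smoothCircle 𝕜) (x : ℝ) :
    (ddx 𝕜 f).1 x = deriv f.1 x := rfl

/-- Leibniz rule for the iterated derivative. -/
theorem ddx_iterate_mul {𝕜 : Type*} [RCLike 𝕜] (n : ℕ) (f g : smoothCircle 𝕜) :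
    (ddx 𝕜)^[n] (f * g) =
      ∑ p ∈ Finset.HasAntidiagonal.antidiagonal n, n.choose p.1 • ((ddx 𝕜)^[p.1] f * (ddx 𝕜)^[p.2] g) := by
  induction n with
  | zero => simp
  | succ n ih =>
    rw [Function.iterate_succ_apply', ih, map_sum,
      Finset.sum_antidiagonal_choose_succ_nsmul
        (fun i j => (ddx 𝕜)^[i] f * (ddx 𝕜)^[j] g) n, ← Finset.sum_add_distrib]
    refine Finset.sum_congr rfl fun p _ => ?_
    rw [map_nsmul, Derivation.leibniz, Function.iterate_succ_apply', Function.iterate_succ_apply',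
      smul_eq_mul, smul_eq_mul, nsmul_add, mul_comm ((ddx 𝕜)^[p.2] g)]
    have : n.choose p.2 = n.choose p.1 := by
      have := Finset.HasAntidiagonal.mem_antidiagonal.1 ‹_›
      rw [← this, Nat.choose_symm_add]
    rw [this]

theorem ddx_iterate_sum {𝕜 : Type*} [RCLike 𝕜] {ι : Type*} (n : ℕ) (s : Finset ι)
    (f : ι → smoothCircle 𝕜) : (ddx 𝕜)^[n] (∑ i ∈ s, f i) = ∑ i ∈ s, (ddx 𝕜)^[n] (f i) := by
  induction n generalizing f with
  | zero => rfl
  | succ n ih => simp only [Function.iterate_succ_apply, map_sum, ih]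

theorem ddx_iterate_zsmul {𝕜 : Type*} [RCLike 𝕜] (n : ℕ) (c : ℤ) (f : smoothCircle 𝕜) :
    (ddx 𝕜)^[n] (c • f) = c • (ddx 𝕜)^[n] f := by
  induction n generalizing f with
  | zero => rfl
  | succ n ih => simp only [Function.iterate_succ_apply, map_zsmul, ih]

theorem ddx_iterate_smul {𝕜 : Type*} [RCLike 𝕜] (n : ℕ) (c : 𝕜) (f : smoothCircle 𝕜) :
    (ddx 𝕜)^[n] (c • f) = c • (ddx 𝕜)^[n] f := by
  induction n generalizing f with
  | zero => rfl
  | succ n ih => simp only [Function.iterate_succ_apply, Derivation.map_smul, ih]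

theorem ddx_iterate_zero {𝕜 : Type*} [RCLike 𝕜] (n : ℕ) :
    (ddx 𝕜)^[n] (0 : smoothCircle 𝕜) = 0 := by
  simp

theorem ddx_iterate_add {𝕜 : Type*} [RCLike 𝕜] (n : ℕ) (f g : smoothCircle 𝕜) :
    (ddx 𝕜)^[n] (f + g) = (ddx 𝕜)^[n] f + (ddx 𝕜)^[n] g := by
  induction n generalizing f g with
  | zero => rfl
  | succ n ih => simp only [Function.iterate_succ_apply, map_add, ih]

/-! ### Pseudodifferential symbols -/

/-- Sequences `(f_k)_{k ∈ ℤ}` in `C^∞(S¹)` with `f_k = 0` for all sufficiently large `k`. -/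
def symbolSubmodule (𝕜 : Type*) [RCLike 𝕜] : Submodule 𝕜 (ℤ → smoothCircle 𝕜) where
  carrier := {F | ∃ N : ℤ, ∀ k, N < k → F k = 0}
  add_mem' := by
    rintro F G ⟨N, hN⟩ ⟨M, hM⟩
    refine ⟨max N M, fun k hk => ?_⟩
    simp [hN k (lt_of_le_of_lt (le_max_left _ _) hk), hM k (lt_of_le_of_lt (le_max_right _ _) hk)]
  zero_mem' := ⟨0, fun _ _ => rfl⟩
  smul_mem' := by
    rintro c F ⟨N, hN⟩
    exact ⟨N, fun k hk => by simp [hN k hk]⟩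

/-- `ΨD(S¹)`: the formal series `F(x, ξ) = ∑_{k ∈ ℤ} f_k(x) ξ^k` of finite order in `ξ`,
i.e. `f_k ∈ C^∞(S¹)` and `f_k = 0` for all sufficiently large `k`. -/
def PsiD (𝕜 : Type*) [RCLike 𝕜] : Type _ := symbolSubmodule 𝕜

instance (𝕜 : Type*) [RCLike 𝕜] : AddCommGroup (PsiD 𝕜) :=
  inferInstanceAs (AddCommGroup (symbolSubmodule 𝕜))

instance (𝕜 : Type*) [RCLike 𝕜] : Module 𝕜 (PsiD 𝕜) :=
  inferInstanceAs (Module 𝕜 (symbolSubmodule 𝕜))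

namespace PsiD

/-- The coefficient `f_k` of `ξ^k`. -/
def coeff {𝕜 : Type*} [RCLike 𝕜] (F : PsiD 𝕜) (k : ℤ) : smoothCircle 𝕜 := F.1 k

@[ext]
theorem ext {𝕜 : Type*} [RCLike 𝕜] {F G : PsiD 𝕜} (h : ∀ k, F.coeff k = G.coeff k) : F = G :=
  Subtype.ext (funext h)

@[simp]
theorem coeff_add {𝕜 : Type*} [RCLike 𝕜] (F G : PsiD 𝕜) (k : ℤ) :
    (F + G).coeff k = F.coeff k + G.coeff k := rfl

@[simp]
theorem coeff_sub {𝕜 : Type*} [RCLike 𝕜] (F G : PsiD 𝕜) (k : ℤ) :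
    (F - G).coeff k = F.coeff k - G.coeff k := rfl

@[simp]
theorem coeff_smul {𝕜 : Type*} [RCLike 𝕜] (c : 𝕜) (F : PsiD 𝕜) (k : ℤ) :
    (c • F).coeff k = c • F.coeff k := rfl

@[simp]
theorem coeff_zero {𝕜 : Type*} [RCLike 𝕜] (k : ℤ) : (0 : PsiD 𝕜).coeff k = 0 := rfl

/-- A symbol from its coefficients. -/
def mk {𝕜 : Type*} [RCLike 𝕜] (c : ℤ → smoothCircle 𝕜) (h : ∃ N : ℤ, ∀ k, N < k → c k = 0) :
    PsiD 𝕜 := ⟨c, h⟩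

@[simp]
theorem coeff_mk {𝕜 : Type*} [RCLike 𝕜] (c : ℤ → smoothCircle 𝕜)
    (h : ∃ N : ℤ, ∀ k, N < k → c k = 0) (k : ℤ) : (mk c h).coeff k = c k := rfl

/-- The symbol `f(x) ξ^k`. -/
def monomial {𝕜 : Type*} [RCLike 𝕜] (k : ℤ) (f : smoothCircle 𝕜) : PsiD 𝕜 :=
  mk (Pi.single k f) ⟨k, fun j hj => by simp [hj.ne']⟩

@[simp]
theorem coeff_monomial {𝕜 : Type*} [RCLike 𝕜] (k j : ℤ) (f : smoothCircle 𝕜) :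
    (monomial k f).coeff j = if j = k then f else 0 := by
  simp [monomial, Pi.single_apply]

/-- The contribution of the pair `f_i ξ^i`, `∂_ξ^n` to the coefficient of `ξ^m` in the composition
`F ∘ G = ∑_n (1/n!) :∂_ξ^n F · ∂_x^n G:`. Here `(1/n!) ∂_ξ^n ξ^i = (i choose n) ξ^(i-n)`, with the
generalized binomial coefficient `i (i-1) ⋯ (i-n+1) / n!` for `i ∈ ℤ`. -/
def mulTerm {𝕜 : Type*} [RCLike 𝕜] (F G : PsiD 𝕜) (m : ℤ) (p : ℤ × ℕ) : smoothCircle 𝕜 :=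
  Ring.choose p.1 p.2 • (F.coeff p.1 * (ddx 𝕜)^[p.2] (G.coeff (m - (p.1 - p.2))))

theorem mulTerm_eq_zero {𝕜 : Type*} [RCLike 𝕜] (F G : PsiD 𝕜) {N M : ℤ}
    (hF : ∀ k, N < k → F.coeff k = 0) (hG : ∀ k, M < k → G.coeff k = 0) (m : ℤ) (p : ℤ × ℕ)
    (h : N < p.1 ∨ M < m - (p.1 - p.2)) : mulTerm F G m p = 0 := by
  rcases h with h | h
  · simp [mulTerm, hF _ h]
  · simp [mulTerm, hG _ h]

/-- The composition `F ∘ G = ∑_{n ≥ 0} (1/n!) :∂_ξ^n F · ∂_x^n G:`. The sum that gives the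
coefficient of `ξ^m` has finite support (see `coeff_mul_eq_sum`). -/
instance (𝕜 : Type*) [RCLike 𝕜] : Mul (PsiD 𝕜) where
  mul F G := mk (fun m => ∑ᶠ p : ℤ × ℕ, mulTerm F G m p) (by
    obtain ⟨N, hN⟩ := F.2
    obtain ⟨M, hM⟩ := G.2
    refine ⟨N + M, fun m hm => finsum_eq_zero_of_forall_eq_zero fun p => ?_⟩
    exact mulTerm_eq_zero F G hN hM m p (by omega))

theorem coeff_mul {𝕜 : Type*} [RCLike 𝕜] (F G : PsiD 𝕜) (m : ℤ) :
    (F * G).coeff m = ∑ᶠ p : ℤ × ℕ, mulTerm F G m p := rfl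

/-- The composition as a sum over pairs of coefficients. -/
def pairTerm {𝕜 : Type*} [RCLike 𝕜] (f g : smoothCircle 𝕜) (i j m : ℤ) : smoothCircle 𝕜 :=
  if m ≤ i + j then
    Ring.choose i (i + j - m).toNat • (f * (ddx 𝕜)^[(i + j - m).toNat] g) else 0

theorem coeff_mul_eq_sum {𝕜 : Type*} [RCLike 𝕜] (F G : PsiD 𝕜) {N M : ℤ}
    (hF : ∀ k, N < k → F.coeff k = 0) (hG : ∀ k, M < k → G.coeff k = 0) (m : ℤ)
    {a b c d : ℤ} (ha : a ≤ m - M) (hb : N ≤ b) (hc : c ≤ m - N) (hd : M ≤ d) :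
    (F * G).coeff m =
      ∑ i ∈ Finset.Icc a b, ∑ j ∈ Finset.Icc c d, pairTerm (F.coeff i) (G.coeff j) i j m := by
  rw [coeff_mul, ← Finset.sum_product']
  have e : ∑ x ∈ Finset.Icc a b ×ˢ Finset.Icc c d,
        pairTerm (F.coeff x.1) (G.coeff x.2) x.1 x.2 m =
      ∑ x ∈ (Finset.Icc a b ×ˢ Finset.Icc c d).filter (fun x => m ≤ x.1 + x.2),
        mulTerm F G m (x.1, (x.1 + x.2 - m).toNat) := by
    rw [Finset.sum_filter]
    refine Finset.sum_congr rfl fun x _ => ?_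
    unfold pairTerm mulTerm
    split_ifs with h
    · have : m - (x.1 - ((x.1 + x.2 - m).toNat : ℤ)) = x.2 := by omega
      rw [this]
    · rfl
  rw [e, ← Finset.sum_image (f := mulTerm F G m)
    (g := fun x : ℤ × ℤ => (x.1, (x.1 + x.2 - m).toNat))]
  · refine finsum_eq_sum_of_support_subset _ fun p hp => ?_
    have h1 : ¬ (N < p.1 ∨ M < m - (p.1 - p.2)) := fun h =>
      hp (mulTerm_eq_zero F G hF hG m p h)
    push Not at h1
    simp only [Finset.coe_image, Set.mem_image, Finset.mem_coe, Finset.mem_filter,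
      Finset.mem_product, Finset.mem_Icc]
    refine ⟨(p.1, m - (p.1 - p.2)), ?_, ?_⟩
    · dsimp only; omega
    · ext
      · rfl
      · dsimp only; omega
  · intro x hx y hy hxy
    simp only [Finset.coe_filter, Finset.mem_product, Set.mem_ofPred_eq] at hx hy
    simp only [Prod.mk.injEq] at hxy
    ext
    · exact hxy.1
    · omega

theorem exists_bound {𝕜 : Type*} [RCLike 𝕜] (F : PsiD 𝕜) :
    ∃ N : ℤ, 0 ≤ N ∧ ∀ M, N ≤ M → ∀ k, M < k → F.coeff k = 0 := by
  obtain ⟨N, hN⟩ := F.2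
  exact ⟨max N 0, le_max_right _ _, fun M hM k hk => hN k (by omega)⟩

theorem pairTerm_zero_left {𝕜 : Type*} [RCLike 𝕜] (g : smoothCircle 𝕜) (i j m : ℤ) :
    pairTerm 0 g i j m = 0 := by simp [pairTerm]

theorem pairTerm_zero_right {𝕜 : Type*} [RCLike 𝕜] (f : smoothCircle 𝕜) (i j m : ℤ) :
    pairTerm f 0 i j m = 0 := by simp [pairTerm]

theorem pairTerm_sum_left {𝕜 : Type*} [RCLike 𝕜] {ι : Type*} (s : Finset ι)
    (f : ι → smoothCircle 𝕜) (g : smoothCircle 𝕜) (i j m : ℤ) :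
    pairTerm (∑ x ∈ s, f x) g i j m = ∑ x ∈ s, pairTerm (f x) g i j m := by
  unfold pairTerm
  split_ifs
  · rw [Finset.sum_mul, Finset.smul_sum]
  · simp

theorem pairTerm_sum_right {𝕜 : Type*} [RCLike 𝕜] {ι : Type*} (s : Finset ι)
    (f : smoothCircle 𝕜) (g : ι → smoothCircle 𝕜) (i j m : ℤ) :
    pairTerm f (∑ x ∈ s, g x) i j m = ∑ x ∈ s, pairTerm f (g x) i j m := by
  unfold pairTerm
  split_ifs
  · rw [ddx_iterate_sum, Finset.mul_sum, Finset.smul_sum]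
  · simp

theorem pairTerm_add_left {𝕜 : Type*} [RCLike 𝕜] (f f₁ g : smoothCircle 𝕜) (i j m : ℤ) :
    pairTerm (f + f₁) g i j m = pairTerm f g i j m + pairTerm f₁ g i j m := by
  unfold pairTerm
  split_ifs
  · rw [add_mul, smul_add]
  · simp

theorem pairTerm_add_right {𝕜 : Type*} [RCLike 𝕜] (f g g₁ : smoothCircle 𝕜) (i j m : ℤ) :
    pairTerm f (g + g₁) i j m = pairTerm f g i j m + pairTerm f g₁ i j m := by
  unfold pairTerm
  split_ifs
  · rw [ddx_iterate_add, mul_add, smul_add]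
  · simp

theorem pairTerm_smul_left {𝕜 : Type*} [RCLike 𝕜] (c : 𝕜) (f g : smoothCircle 𝕜) (i j m : ℤ) :
    pairTerm (c • f) g i j m = c • pairTerm f g i j m := by
  unfold pairTerm
  split_ifs
  · rw [smul_mul_assoc, smul_comm]
  · simp

theorem pairTerm_smul_right {𝕜 : Type*} [RCLike 𝕜] (c : 𝕜) (f g : smoothCircle 𝕜) (i j m : ℤ) :
    pairTerm f (c • g) i j m = c • pairTerm f g i j m := by
  unfold pairTerm
  split_ifs
  · rw [ddx_iterate_smul, mul_smul_comm, smul_comm]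
  · simp

/-- Sums over an integer box turned into sums over an antidiagonal. -/
theorem sum_Icc_eq_sum_antidiagonal {A : Type*} [AddCommMonoid A] (u v : ℤ) (s : ℕ) (lo hi : ℤ)
    (hs : (s : ℤ) = u - v) (hlo : lo ≤ v) (hhi : u ≤ hi) (t : ℤ → A) (T : ℕ × ℕ → A)
    (h0 : ∀ n, n < v ∨ u < n → t n = 0)
    (h : ∀ k l : ℕ, k + l = s → t (v + k) = T (k, l)) :
    ∑ n ∈ Finset.Icc lo hi, t n = ∑ p ∈ Finset.HasAntidiagonal.antidiagonal s, T p := by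
  have h1 : ∑ n ∈ Finset.Icc v u, t n = ∑ n ∈ Finset.Icc lo hi, t n := by
    apply Finset.sum_subset (Finset.Icc_subset_Icc hlo hhi)
    intro n _ hn
    apply h0
    simp only [Finset.mem_Icc] at hn
    omega
  rw [← h1]
  refine Finset.sum_bij' (fun n _ => ((n - v).toNat, (u - n).toNat)) (fun p _ => v + p.1)
    ?_ ?_ ?_ ?_ ?_
  · intro n hn
    simp only [Finset.mem_Icc] at hn
    simp only [Finset.HasAntidiagonal.mem_antidiagonal]
    omega
  · intro p hp
    simp only [Finset.HasAntidiagonal.mem_antidiagonal] at hp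
    simp only [Finset.mem_Icc]
    omega
  · intro n hn
    simp only [Finset.mem_Icc] at hn
    dsimp only
    omega
  · intro p hp
    simp only [Finset.HasAntidiagonal.mem_antidiagonal] at hp
    ext <;> dsimp only <;> omega
  · intro n hn
    simp only [Finset.mem_Icc] at hn
    rw [← h (n - v).toNat (u - n).toNat (by omega)]
    congr 1
    omega

theorem pairTerm_assoc {𝕜 : Type*} [RCLike 𝕜] (f g h : smoothCircle 𝕜) (i j p m : ℤ)
    (lo hi lo' hi' : ℤ) (h1 : lo ≤ m - p) (h2 : i + j ≤ hi) (h3 : lo' ≤ m - i)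
    (h4 : j + p ≤ hi') :
    ∑ n ∈ Finset.Icc lo hi, pairTerm (pairTerm f g i j n) h n p m =
      ∑ q ∈ Finset.Icc lo' hi', pairTerm f (pairTerm g h j p q) i q m := by
  by_cases hs : m ≤ i + j + p
  · obtain ⟨s, hs'⟩ := Int.eq_ofNat_of_zero_le (sub_nonneg.2 hs)
    rw [sum_Icc_eq_sum_antidiagonal (i + j) (m - p) s lo hi (by omega) h1 h2 _
      (fun r => (Ring.choose (i + j - (r.2 : ℤ)) r.1 * Ring.choose i r.2) •
        (f * (ddx 𝕜)^[r.2] g * (ddx 𝕜)^[r.1] h))]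
    · rw [sum_Icc_eq_sum_antidiagonal (j + p) (m - i) s lo' hi' (by omega) h3 h4 _
        (fun r => ∑ w ∈ Finset.HasAntidiagonal.antidiagonal r.1,
          (Ring.choose i r.1 * Ring.choose j r.2 * (r.1.choose w.1 : ℤ)) •
          (f * (ddx 𝕜)^[w.1] g * (ddx 𝕜)^[w.2 + r.2] h))]
      · have e : ∀ r ∈ Finset.HasAntidiagonal.antidiagonal s,
            (Ring.choose (i + j - (r.2 : ℤ)) r.1 * Ring.choose i r.2) •
              (f * (ddx 𝕜)^[r.2] g * (ddx 𝕜)^[r.1] h) =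
            ∑ w ∈ Finset.HasAntidiagonal.antidiagonal r.1,
              (Ring.choose (i - (r.2 : ℤ)) w.1 * Ring.choose j w.2 * Ring.choose i r.2) •
              (f * (ddx 𝕜)^[r.2] g * (ddx 𝕜)^[r.1] h) := by
          intro r _
          rw [show i + j - (r.2 : ℤ) = (i - r.2) + j by ring,
            Ring.add_choose_eq r.1 (Commute.all _ _), Finset.sum_mul, Finset.sum_smul]
        rw [Finset.sum_congr rfl e, Finset.sum_sigma', Finset.sum_sigma']
        refine Finset.sum_bij' (fun x _ => ⟨(x.1.2 + x.2.1, x.2.2), (x.1.2, x.2.1)⟩)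
          (fun x _ => ⟨(x.2.2 + x.1.2, x.2.1), (x.2.2, x.1.2)⟩) ?_ ?_ ?_ ?_ ?_
        · rintro ⟨⟨k, l⟩, c, b⟩ hx
          simp only [Finset.mem_sigma, Finset.HasAntidiagonal.mem_antidiagonal] at hx ⊢
          exact ⟨by omega, trivial⟩
        · rintro ⟨⟨a, b⟩, l, c⟩ hx
          simp only [Finset.mem_sigma, Finset.HasAntidiagonal.mem_antidiagonal] at hx ⊢
          exact ⟨by omega, trivial⟩
        · rintro ⟨⟨k, l⟩, c, b⟩ hx
          simp only [Finset.mem_sigma, Finset.HasAntidiagonal.mem_antidiagonal] at hx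
          obtain ⟨-, rfl⟩ := hx
          rfl
        · rintro ⟨⟨a, b⟩, l, c⟩ hx
          simp only [Finset.mem_sigma, Finset.HasAntidiagonal.mem_antidiagonal] at hx
          obtain ⟨-, rfl⟩ := hx
          rfl
        · rintro ⟨⟨k, l⟩, c, b⟩ hx
          simp only [Finset.mem_sigma, Finset.HasAntidiagonal.mem_antidiagonal] at hx
          obtain ⟨-, rfl⟩ := hx
          dsimp only
          have h5 := Ring.choose_smul_choose i (Nat.le_add_right l c)
          rw [Nat.add_sub_cancel_left, nsmul_eq_mul] at h5
          congr 1
          linear_combination (-Ring.choose j b) * h5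
      · rintro n (hn | hn)
        · simp [pairTerm, show ¬ m ≤ i + n by omega]
        · simp [pairTerm, show ¬ n ≤ j + p by omega]
      · intro k l hkl
        unfold pairTerm
        have e1 : (i + (m - i + k) - m).toNat = k := by omega
        have e2 : (j + p - (m - i + (k : ℤ))).toNat = l := by omega
        rw [if_pos (by omega), if_pos (by omega), e1, e2, ddx_iterate_zsmul, ddx_iterate_mul,
          Finset.smul_sum, Finset.mul_sum, Finset.smul_sum]
        refine Finset.sum_congr rfl fun w _ => ?_
        rw [← natCast_zsmul, mul_smul_comm, mul_smul_comm, smul_smul, smul_smul,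
          ← Function.iterate_add_apply, mul_assoc f]
    · rintro n (hn | hn)
      · simp [pairTerm, show ¬ m ≤ n + p by omega]
      · simp [pairTerm, show ¬ n ≤ i + j by omega]
    · intro k l hkl
      unfold pairTerm
      have e1 : (m - p + k + p - m).toNat = k := by omega
      have e2 : (i + j - (m - p + (k : ℤ))).toNat = l := by omega
      have e3 : m - p + (k : ℤ) = i + j - l := by omega
      rw [if_pos (by omega), if_pos (by omega), e1, e2, e3, smul_mul_assoc, smul_smul]
  · rw [Finset.sum_eq_zero, Finset.sum_eq_zero]
    · intro q _
      by_cases hq : m ≤ i + q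
      · simp [pairTerm, show ¬ q ≤ j + p by omega]
      · simp [pairTerm, hq]
    · intro n _
      by_cases hn : m ≤ n + p
      · simp [pairTerm, show ¬ n ≤ i + j by omega]
      · simp [pairTerm, hn]

instance (𝕜 : Type*) [RCLike 𝕜] : One (PsiD 𝕜) := ⟨monomial 0 1⟩

theorem one_def {𝕜 : Type*} [RCLike 𝕜] : (1 : PsiD 𝕜) = monomial 0 1 := rfl

/-- Composition by a monomial `f(x) ξ^i` on the left. -/
theorem coeff_monomial_mul {𝕜 : Type*} [RCLike 𝕜] (i : ℤ) (f : smoothCircle 𝕜) (G : PsiD 𝕜)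
    (m : ℤ) {K : ℕ} (hK : ∀ k : ℕ, K ≤ k → Ring.choose i k = 0) :
    (monomial i f * G).coeff m =
      ∑ k ∈ Finset.range K, Ring.choose i k • (f * (ddx 𝕜)^[k] (G.coeff (m - (i - k)))) := by
  have e : ∑ k ∈ Finset.range K, Ring.choose i k • (f * (ddx 𝕜)^[k] (G.coeff (m - (i - k)))) =
      ∑ p ∈ ({i} : Finset ℤ) ×ˢ Finset.range K, mulTerm (monomial i f) G m p := by
    rw [Finset.sum_product]
    simp [mulTerm]
  rw [coeff_mul, e]
  refine finsum_eq_sum_of_support_subset _ fun p hp => ?_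
  rw [Function.mem_support] at hp
  simp only [Finset.coe_product, Finset.coe_singleton, Finset.coe_range, Set.mem_prod,
    Set.mem_singleton_iff, Set.mem_Iio]
  have h1 : p.1 = i := by
    by_contra h
    exact hp (by simp [mulTerm, h])
  refine ⟨h1, ?_⟩
  by_contra h
  exact hp (by simp [mulTerm, h1, hK p.2 (not_lt.1 h)])

theorem coeff_monomial_zero_mul {𝕜 : Type*} [RCLike 𝕜] (f : smoothCircle 𝕜) (G : PsiD 𝕜)
    (m : ℤ) : (monomial 0 f * G).coeff m = f * G.coeff m := by
  rw [coeff_monomial_mul (K := 1) 0 f G m fun k hk => Ring.choose_zero_pos ℤ (by omega)]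
  simp

theorem coeff_monomial_one_mul {𝕜 : Type*} [RCLike 𝕜] (f : smoothCircle 𝕜) (G : PsiD 𝕜)
    (m : ℤ) : (monomial 1 f * G).coeff m = f * G.coeff (m - 1) + f * ddx 𝕜 (G.coeff m) := by
  rw [coeff_monomial_mul (K := 2) 1 f G m fun k hk => by
    have := Ring.choose_natCast (R := ℤ) 1 k
    rw [Nat.cast_one] at this
    rw [this, Nat.choose_eq_zero_of_lt (by omega), Nat.cast_zero]]
  simp [Finset.sum_range_succ]

theorem ddx_iterate_one {𝕜 : Type*} [RCLike 𝕜] (k : ℕ) (hk : k ≠ 0) :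
    (ddx 𝕜)^[k] (1 : smoothCircle 𝕜) = 0 := by
  obtain ⟨n, rfl⟩ := Nat.exists_eq_succ_of_ne_zero hk
  rw [Function.iterate_succ_apply, Derivation.map_one_eq_zero, ddx_iterate_zero]

theorem coeff_mul_one {𝕜 : Type*} [RCLike 𝕜] (F : PsiD 𝕜) (m : ℤ) :
    (F * monomial 0 1).coeff m = F.coeff m := by
  rw [coeff_mul, finsum_eq_single _ ((m, 0) : ℤ × ℕ)]
  · simp [mulTerm]
  · rintro ⟨i, k⟩ hp
    by_cases h : m - (i - (k : ℤ)) = 0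
    · have hk : k ≠ 0 := by
        rintro rfl
        apply hp
        ext
        · dsimp only; push_cast at h; omega
        · rfl
      simp [mulTerm, h, ddx_iterate_one k hk]
    · simp [mulTerm, h]

theorem mul_assoc_aux {𝕜 : Type*} [RCLike 𝕜] (F G H : PsiD 𝕜) : F * G * H = F * (G * H) := by
  obtain ⟨N₁, h₁, hF⟩ := F.exists_bound
  obtain ⟨N₂, h₂, hG⟩ := G.exists_bound
  obtain ⟨N₃, h₃, hH⟩ := H.exists_bound
  obtain ⟨N₄, h₄, hFG⟩ := (F * G).exists_bound
  obtain ⟨N₅, h₅, hGH⟩ := (G * H).exists_bound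
  obtain ⟨N, hN⟩ : ∃ N, N = N₁ + N₂ + N₃ + N₄ + N₅ := ⟨_, rfl⟩
  replace hF := hF N (by omega)
  replace hG := hG N (by omega)
  replace hH := hH N (by omega)
  replace hFG := hFG N (by omega)
  replace hGH := hGH N (by omega)
  ext1 m
  set B := Finset.Icc (m - 2 * N) (2 * N) with hB
  rw [coeff_mul_eq_sum (F * G) H hFG hH m (a := m - N) (b := 2 * N) (c := m - 2 * N)
    (d := 2 * N) (by omega) (by omega) (by omega) (by omega),
    coeff_mul_eq_sum F (G * H) hF hGH m (a := m - 2 * N) (b := 2 * N) (c := m - N)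
    (d := 2 * N) (by omega) (by omega) (by omega) (by omega)]
  have l : ∀ n ∈ Finset.Icc (m - N) (2 * N), ∀ p ∈ B,
      pairTerm ((F * G).coeff n) (H.coeff p) n p m =
        ∑ i ∈ B, ∑ j ∈ B,
          pairTerm (pairTerm (F.coeff i) (G.coeff j) i j n) (H.coeff p) n p m := by
    intro n hn p _
    rw [Finset.mem_Icc] at hn
    rw [coeff_mul_eq_sum F G hF hG n (a := m - 2 * N) (b := 2 * N) (c := m - 2 * N)
      (d := 2 * N) (by omega) (by omega) (by omega) (by omega), pairTerm_sum_left]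
    simp_rw [pairTerm_sum_left, hB]
  have r : ∀ i ∈ B, ∀ q ∈ Finset.Icc (m - N) (2 * N),
      pairTerm (F.coeff i) ((G * H).coeff q) i q m =
        ∑ j ∈ B, ∑ p ∈ B,
          pairTerm (F.coeff i) (pairTerm (G.coeff j) (H.coeff p) j p q) i q m := by
    intro i _ q hq
    rw [Finset.mem_Icc] at hq
    rw [coeff_mul_eq_sum G H hG hH q (a := m - 2 * N) (b := 2 * N) (c := m - 2 * N)
      (d := 2 * N) (by omega) (by omega) (by omega) (by omega), pairTerm_sum_right]
    simp_rw [pairTerm_sum_right, hB]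
  rw [Finset.sum_congr rfl fun n hn => Finset.sum_congr rfl (l n hn),
    Finset.sum_congr rfl fun i hi => Finset.sum_congr rfl (r i hi)]
  have key : ∀ i ∈ B, ∀ j ∈ B, ∀ p ∈ B,
      ∑ n ∈ Finset.Icc (m - N) (2 * N),
        pairTerm (pairTerm (F.coeff i) (G.coeff j) i j n) (H.coeff p) n p m =
      ∑ q ∈ Finset.Icc (m - N) (2 * N),
        pairTerm (F.coeff i) (pairTerm (G.coeff j) (H.coeff p) j p q) i q m := by
    intro i _ j _ p _
    by_cases hi : N < i
    · simp [hF i hi, pairTerm_zero_left]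
    by_cases hj : N < j
    · simp [hG j hj, pairTerm_zero_left, pairTerm_zero_right]
    by_cases hp : N < p
    · simp [hH p hp, pairTerm_zero_right]
    exact pairTerm_assoc _ _ _ i j p m _ _ _ _ (by omega) (by omega) (by omega) (by omega)
  calc _ = ∑ i ∈ B, ∑ j ∈ B, ∑ p ∈ B, ∑ n ∈ Finset.Icc (m - N) (2 * N),
        pairTerm (pairTerm (F.coeff i) (G.coeff j) i j n) (H.coeff p) n p m := by
        rw [Finset.sum_comm]
        simp_rw [Finset.sum_comm (s := Finset.Icc (m - N) (2 * N))]
        rw [Finset.sum_comm]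
        exact Finset.sum_congr rfl fun i _ => Finset.sum_comm
    _ = ∑ i ∈ B, ∑ j ∈ B, ∑ p ∈ B, ∑ q ∈ Finset.Icc (m - N) (2 * N),
        pairTerm (F.coeff i) (pairTerm (G.coeff j) (H.coeff p) j p q) i q m :=
        Finset.sum_congr rfl fun i hi => Finset.sum_congr rfl fun j hj =>
          Finset.sum_congr rfl fun p hp => key i hi j hj p hp
    _ = _ := by
        refine Finset.sum_congr rfl fun i _ => ?_
        simp_rw [Finset.sum_comm (t := Finset.Icc (m - N) (2 * N))]

theorem left_distrib_aux {𝕜 : Type*} [RCLike 𝕜] (F G H : PsiD 𝕜) :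
    F * (G + H) = F * G + F * H := by
  obtain ⟨N₁, h₁, hF⟩ := F.exists_bound
  obtain ⟨N₂, h₂, hG⟩ := G.exists_bound
  obtain ⟨N₃, h₃, hH⟩ := H.exists_bound
  replace hF := hF (N₁ + N₂ + N₃) (by omega)
  replace hG := hG (N₁ + N₂ + N₃) (by omega)
  replace hH := hH (N₁ + N₂ + N₃) (by omega)
  ext1 m
  rw [coeff_add, coeff_mul_eq_sum F (G + H) hF (fun k hk => by simp [hG k hk, hH k hk]) m
      le_rfl le_rfl le_rfl le_rfl, coeff_mul_eq_sum F G hF hG m le_rfl le_rfl le_rfl le_rfl,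
    coeff_mul_eq_sum F H hF hH m le_rfl le_rfl le_rfl le_rfl, ← Finset.sum_add_distrib]
  refine Finset.sum_congr rfl fun i _ => ?_
  rw [← Finset.sum_add_distrib]
  exact Finset.sum_congr rfl fun j _ => by rw [coeff_add, pairTerm_add_right]

theorem right_distrib_aux {𝕜 : Type*} [RCLike 𝕜] (F G H : PsiD 𝕜) :
    (F + G) * H = F * H + G * H := by
  obtain ⟨N₁, h₁, hF⟩ := F.exists_bound
  obtain ⟨N₂, h₂, hG⟩ := G.exists_bound
  obtain ⟨N₃, h₃, hH⟩ := H.exists_bound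
  replace hF := hF (N₁ + N₂ + N₃) (by omega)
  replace hG := hG (N₁ + N₂ + N₃) (by omega)
  replace hH := hH (N₁ + N₂ + N₃) (by omega)
  ext1 m
  rw [coeff_add, coeff_mul_eq_sum (F + G) H (fun k hk => by simp [hF k hk, hG k hk]) hH m
      le_rfl le_rfl le_rfl le_rfl, coeff_mul_eq_sum F H hF hH m le_rfl le_rfl le_rfl le_rfl,
    coeff_mul_eq_sum G H hG hH m le_rfl le_rfl le_rfl le_rfl, ← Finset.sum_add_distrib]
  refine Finset.sum_congr rfl fun i _ => ?_
  rw [← Finset.sum_add_distrib]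
  exact Finset.sum_congr rfl fun j _ => by rw [coeff_add, pairTerm_add_left]

theorem smul_mul_aux {𝕜 : Type*} [RCLike 𝕜] (c : 𝕜) (F G : PsiD 𝕜) :
    c • F * G = c • (F * G) := by
  obtain ⟨N, hF⟩ := F.2
  obtain ⟨M, hG⟩ := G.2
  ext1 m
  rw [coeff_smul, coeff_mul_eq_sum F G hF hG m le_rfl le_rfl le_rfl le_rfl,
    coeff_mul_eq_sum (c • F) G (N := N) (fun k hk => by
      rw [coeff_smul, coeff, hF k hk, smul_zero]) hG m le_rfl le_rfl le_rfl le_rfl]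
  simp_rw [Finset.smul_sum, coeff_smul, pairTerm_smul_left]

theorem mul_smul_aux {𝕜 : Type*} [RCLike 𝕜] (c : 𝕜) (F G : PsiD 𝕜) :
    F * c • G = c • (F * G) := by
  obtain ⟨N, hF⟩ := F.2
  obtain ⟨M, hG⟩ := G.2
  ext1 m
  rw [coeff_smul, coeff_mul_eq_sum F G hF hG m le_rfl le_rfl le_rfl le_rfl,
    coeff_mul_eq_sum F (c • G) (M := M) hF (fun k hk => by
      rw [coeff_smul, coeff, hG k hk, smul_zero]) m le_rfl le_rfl le_rfl le_rfl]
  simp_rw [Finset.smul_sum, coeff_smul, pairTerm_smul_right]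

/-- `ΨD(S¹)` is an associative unital ring for the composition of symbols. -/
instance (𝕜 : Type*) [RCLike 𝕜] : Ring (PsiD 𝕜) where
  __ := (inferInstance : AddCommGroup (PsiD 𝕜))
  mul_assoc := mul_assoc_aux
  left_distrib := left_distrib_aux
  right_distrib := right_distrib_aux
  one_mul F := ext fun k => by rw [one_def, coeff_monomial_zero_mul, one_mul]
  mul_one F := ext fun k => by rw [one_def, coeff_mul_one]
  zero_mul F := by simpa using smul_mul_aux (0 : 𝕜) 0 F
  mul_zero F := by simpa using mul_smul_aux (0 : 𝕜) F 0

/-- `ΨD(S¹)` is an associative algebra over `𝕜`. -/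
instance (𝕜 : Type*) [RCLike 𝕜] : Algebra 𝕜 (PsiD 𝕜) :=
  Algebra.ofModule smul_mul_aux mul_smul_aux

/-- `ΨD(S¹)` is a Lie algebra for the commutator `⁅F, G⁆ = F * G - G * F`. -/
instance (𝕜 : Type*) [RCLike 𝕜] : LieRing (PsiD 𝕜) := LieRing.ofAssociativeRing

instance (𝕜 : Type*) [RCLike 𝕜] : LieAlgebra 𝕜 (PsiD 𝕜) := LieAlgebra.ofAssociativeAlgebra

theorem lie_eq {𝕜 : Type*} [RCLike 𝕜] (F G : PsiD 𝕜) : ⁅F, G⁆ = F * G - G * F := rfl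

end PsiD

/-! ### Vector fields on the circle -/

/-- `Vect(S¹)`: a vector field `f(x) ∂`, `∂ = d/dx`, is recorded by its coefficient `f`. -/
def VectS1 (𝕜 : Type*) [RCLike 𝕜] : Type _ := smoothCircle 𝕜

instance (𝕜 : Type*) [RCLike 𝕜] : AddCommGroup (VectS1 𝕜) :=
  inferInstanceAs (AddCommGroup (smoothCircle 𝕜))

instance (𝕜 : Type*) [RCLike 𝕜] : Module 𝕜 (VectS1 𝕜) :=
  inferInstanceAs (Module 𝕜 (smoothCircle 𝕜))

namespace VectS1

/-- The coefficient `f` of the vector field `f ∂`. -/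
def coeff (𝕜 : Type*) [RCLike 𝕜] : VectS1 𝕜 ≃ₗ[𝕜] smoothCircle 𝕜 :=
  LinearEquiv.refl 𝕜 (smoothCircle 𝕜)

/-- The bracket `[f ∂, g ∂] = (f g' - f' g) ∂`. -/
instance (𝕜 : Type*) [RCLike 𝕜] : Bracket (VectS1 𝕜) (VectS1 𝕜) where
  bracket X Y := (coeff 𝕜).symm (coeff 𝕜 X * ddx 𝕜 (coeff 𝕜 Y) - ddx 𝕜 (coeff 𝕜 X) * coeff 𝕜 Y)

theorem coeff_lie {𝕜 : Type*} [RCLike 𝕜] (X Y : VectS1 𝕜) :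
    coeff 𝕜 ⁅X, Y⁆ = coeff 𝕜 X * ddx 𝕜 (coeff 𝕜 Y) - ddx 𝕜 (coeff 𝕜 X) * coeff 𝕜 Y := rfl

instance (𝕜 : Type*) [RCLike 𝕜] : LieRing (VectS1 𝕜) where
  add_lie X Y Z := (coeff 𝕜).injective (by simp only [coeff_lie, map_add]; ring)
  lie_add X Y Z := (coeff 𝕜).injective (by simp only [coeff_lie, map_add]; ring)
  lie_self X := (coeff 𝕜).injective (by simp only [coeff_lie, map_zero]; ring)
  leibniz_lie X Y Z := (coeff 𝕜).injective (by
    simp only [coeff_lie, map_add, map_sub, Derivation.leibniz, smul_eq_mul]; ring)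

instance (𝕜 : Type*) [RCLike 𝕜] : LieAlgebra 𝕜 (VectS1 𝕜) where
  lie_smul c X Y := (coeff 𝕜).injective (by
    simp only [coeff_lie, map_smul, Derivation.map_smul, smul_sub, mul_smul_comm])

end VectS1

/-- The standard embedding `π : Vect(S¹) → ΨD(S¹)`, `f ∂ ↦ f ξ`. -/
def stdEmbedding (𝕜 : Type*) [RCLike 𝕜] : VectS1 𝕜 →ₗ⁅𝕜⁆ PsiD 𝕜 where
  toFun X := PsiD.monomial 1 (VectS1.coeff 𝕜 X)
  map_add' X Y := PsiD.ext fun k => by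
    rw [PsiD.coeff_add]; simp only [PsiD.coeff_monomial, map_add]; split_ifs <;> simp
  map_smul' c X := PsiD.ext fun k => by
    rw [RingHom.id_apply, PsiD.coeff_smul]
    simp only [PsiD.coeff_monomial, map_smul]; split_ifs <;> simp
  map_lie' {X Y} := PsiD.ext fun k => by
    change _ = (PsiD.monomial 1 _ * PsiD.monomial 1 _ - PsiD.monomial 1 _ * PsiD.monomial 1 _ :
      PsiD 𝕜).coeff k
    rw [PsiD.coeff_sub, PsiD.coeff_monomial_one_mul, PsiD.coeff_monomial_one_mul]
    simp only [PsiD.coeff_monomial, VectS1.coeff_lie]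
    by_cases h1 : k = 1
    · subst h1
      simp
      ring
    · by_cases h2 : k - 1 = 1
      · simp [h1, h2, mul_comm]
      · simp [h1, h2]

/-- `ΨD(S¹)` as a `Vect(S¹)`-module: `X · F = [π(X), F]`. -/
instance (𝕜 : Type*) [RCLike 𝕜] : LieRingModule (VectS1 𝕜) (PsiD 𝕜) :=
  LieRingModule.compLieHom (PsiD 𝕜) (stdEmbedding 𝕜)

instance (𝕜 : Type*) [RCLike 𝕜] : LieModule 𝕜 (VectS1 𝕜) (PsiD 𝕜) :=
  LieModule.compLieHom (PsiD 𝕜) (stdEmbedding 𝕜)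

theorem lie_def {𝕜 : Type*} [RCLike 𝕜] (X : VectS1 𝕜) (F : PsiD 𝕜) :
    ⁅X, F⁆ = stdEmbedding 𝕜 X * F - F * stdEmbedding 𝕜 X := rfl

/-! ### First cohomology of a Lie algebra -/

section Cohomology

open LieModule.Cohomology

/-- The Chevalley–Eilenberg differential on `0`-cochains: `m ↦ (x ↦ x · m)`. -/
def d₀₁ (R L M : Type*) [CommRing R] [LieRing L] [LieAlgebra R L] [AddCommGroup M] [Module R M]
    [LieRingModule L M] [LieModule R L M] : M →ₗ[R] oneCochain R L M :=
  (LieModule.toEnd R L M : L →ₗ[R] Module.End R M).flip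

@[simp]
theorem d₀₁_apply (R L M : Type*) [CommRing R] [LieRing L] [LieAlgebra R L] [AddCommGroup M]
    [Module R M] [LieRingModule L M] [LieModule R L M] (m : M) (x : L) :
    d₀₁ R L M m x = ⁅x, m⁆ := rfl

/-- `1`-cocycles: linear maps `c : L → M` with `c [x, y] = x · c y - y · c x`. -/
def oneCocycles (R L M : Type*) [CommRing R] [LieRing L] [LieAlgebra R L] [AddCommGroup M]
    [Module R M] [LieRingModule L M] [LieModule R L M] : Submodule R (oneCochain R L M) :=
  LinearMap.ker (d₁₂ R L M)

theorem mem_oneCocycles_iff {R L M : Type*} [CommRing R] [LieRing L] [LieAlgebra R L]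
    [AddCommGroup M] [Module R M] [LieRingModule L M] [LieModule R L M]
    (c : oneCochain R L M) :
    c ∈ oneCocycles R L M ↔ ∀ x y : L, c ⁅x, y⁆ = ⁅x, c y⁆ - ⁅y, c x⁆ := by
  rw [oneCocycles, LinearMap.mem_ker]
  constructor
  · intro h x y
    have h' : d₁₂ R L M c x y = 0 := by rw [h]; rfl
    rw [d₁₂_apply_apply, sub_eq_zero] at h'
    exact h'.symm
  · intro h
    ext x y
    change d₁₂ R L M c x y = 0
    rw [d₁₂_apply_apply, h, sub_self]

/-- `1`-coboundaries. -/
def oneCoboundaries (R L M : Type*) [CommRing R] [LieRing L] [LieAlgebra R L] [AddCommGroup M]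
    [Module R M] [LieRingModule L M] [LieModule R L M] : Submodule R (oneCochain R L M) :=
  LinearMap.range (d₀₁ R L M)

theorem oneCoboundaries_le {R L M : Type*} [CommRing R] [LieRing L] [LieAlgebra R L]
    [AddCommGroup M] [Module R M] [LieRingModule L M] [LieModule R L M] :
    oneCoboundaries R L M ≤ oneCocycles R L M := by
  rintro _ ⟨m, rfl⟩
  rw [mem_oneCocycles_iff]
  intro x y
  simp

/-- The first cohomology `H¹(L; M)`: `1`-cocycles modulo `1`-coboundaries. -/
abbrev H1 (R L M : Type*) [CommRing R] [LieRing L] [LieAlgebra R L] [AddCommGroup M]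
    [Module R M] [LieRingModule L M] [LieModule R L M] : Type _ :=
  oneCocycles R L M ⧸ (oneCoboundaries R L M).submoduleOf (oneCocycles R L M)

/-- The cohomology class of a `1`-cocycle. -/
def H1.classOf {R L M : Type*} [CommRing R] [LieRing L] [LieAlgebra R L] [AddCommGroup M]
    [Module R M] [LieRingModule L M] [LieModule R L M] (c : oneCochain R L M)
    (hc : c ∈ oneCocycles R L M) : H1 R L M :=
  Submodule.Quotient.mk ⟨c, hc⟩

end Cohomology

/-! ### The four cochains -/

/-- The cochain `f ∂ ↦ ∑_{n ≥ 0} a_n f^(n) ξ^(1-n)`, for scalars `a_n`. -/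
def seriesCochain {𝕜 : Type*} [RCLike 𝕜] (a : ℕ → 𝕜) : VectS1 𝕜 →ₗ[𝕜] PsiD 𝕜 where
  toFun X := PsiD.mk
    (fun k => if k ≤ 1 then a (1 - k).toNat • (ddx 𝕜)^[(1 - k).toNat] (VectS1.coeff 𝕜 X) else 0)
    ⟨1, fun _ hk => if_neg (not_le.2 hk)⟩
  map_add' X Y := PsiD.ext fun k => by
    simp only [PsiD.coeff_mk, PsiD.coeff_add, map_add, ddx_iterate_add, smul_add]
    split_ifs <;> simp
  map_smul' c X := PsiD.ext fun k => by
    simp only [PsiD.coeff_mk, RingHom.id_apply, PsiD.coeff_smul, map_smul, ddx_iterate_smul]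
    split_ifs
    · rw [smul_comm]
    · simp

theorem coeff_seriesCochain {𝕜 : Type*} [RCLike 𝕜] (a : ℕ → 𝕜) (X : VectS1 𝕜) (n : ℕ) :
    (seriesCochain a X).coeff (1 - n) = a n • (ddx 𝕜)^[n] (VectS1.coeff 𝕜 X) := by
  simp [seriesCochain]

/-- `θ₀(f ∂) = f`. -/
def theta0 (𝕜 : Type*) [RCLike 𝕜] : VectS1 𝕜 →ₗ[𝕜] PsiD 𝕜 where
  toFun X := PsiD.monomial 0 (VectS1.coeff 𝕜 X)
  map_add' X Y := PsiD.ext fun k => by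
    rw [PsiD.coeff_add]; simp only [PsiD.coeff_monomial, map_add]; split_ifs <;> simp
  map_smul' c X := PsiD.ext fun k => by
    rw [RingHom.id_apply, PsiD.coeff_smul]
    simp only [PsiD.coeff_monomial, map_smul]; split_ifs <;> simp

/-- `θ₁(f ∂) = f'`. -/
def theta1 (𝕜 : Type*) [RCLike 𝕜] : VectS1 𝕜 →ₗ[𝕜] PsiD 𝕜 where
  toFun X := PsiD.monomial 0 (ddx 𝕜 (VectS1.coeff 𝕜 X))
  map_add' X Y := PsiD.ext fun k => by
    rw [PsiD.coeff_add]; simp only [PsiD.coeff_monomial, map_add]; split_ifs <;> simp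
  map_smul' c X := PsiD.ext fun k => by
    rw [RingHom.id_apply, PsiD.coeff_smul]
    simp only [PsiD.coeff_monomial, map_smul, Derivation.map_smul]; split_ifs <;> simp

/-- `θ₂(f ∂) = ∑_{n ≥ 2} (-1)^(n-1) (2 (n - 3) / n) f^(n) ξ^(-n+1)`. -/
def theta2 (𝕜 : Type*) [RCLike 𝕜] : VectS1 𝕜 →ₗ[𝕜] PsiD 𝕜 :=
  seriesCochain fun n => if 2 ≤ n then (-1) ^ (n - 1) * (2 * ((n : 𝕜) - 3) / n) else 0

/-- `θ₃(f ∂) = ∑_{n ≥ 2} (-1)^n (3 (n - 1) / (n + 1)) f^(n+1) ξ^(-n)`; the coefficient of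
`f^(N) ξ^(1-N)`, `N = n + 1 ≥ 3`, is `(-1)^(N-1) 3 (N - 2) / N`. -/
def theta3 (𝕜 : Type*) [RCLike 𝕜] : VectS1 𝕜 →ₗ[𝕜] PsiD 𝕜 :=
  seriesCochain fun N => if 3 ≤ N then (-1) ^ (N - 1) * (3 * ((N : 𝕜) - 2) / N) else 0

/-- The coefficients of `θ₃` in the original indexing. -/
theorem coeff_theta3 {𝕜 : Type*} [RCLike 𝕜] (X : VectS1 𝕜) (n : ℕ) (hn : 2 ≤ n) :
    (theta3 𝕜 X).coeff (-n) =
      ((-1) ^ n * (3 * ((n : 𝕜) - 1) / (n + 1))) • (ddx 𝕜)^[n + 1] (VectS1.coeff 𝕜 X) := by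
  have h := coeff_seriesCochain
    (fun N => if 3 ≤ N then (-1) ^ (N - 1) * (3 * ((N : 𝕜) - 2) / N) else 0) X (n + 1)
  rw [show (1 : ℤ) - ((n + 1 : ℕ) : ℤ) = -n by push_cast; ring, if_pos (by omega)] at h
  rw [theta3, h, Nat.add_sub_cancel]
  congr 3
  · push_cast; ring
  · push_cast; ring

/-- The family `θ₀, θ₁, θ₂, θ₃`. -/
def theta (𝕜 : Type*) [RCLike 𝕜] : Fin 4 → (VectS1 𝕜 →ₗ[𝕜] PsiD 𝕜) :=
  ![theta0 𝕜, theta1 𝕜, theta2 𝕜, theta3 𝕜]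

end PseudoDiff

end

/-!
# First cohomology of `Vect(S¹)` with coefficients in pseudodifferential symbols

The cochains are arbitrary linear maps, without any continuity, so the first task is to show that
cocycles are given by differential operators. This is forced by the cocycle condition alone.

* The order in `ξ` of the values of a cocycle `c` is bounded (`exists_forall_mem_orderLE`). Modulo
  the order of `c` at `∂`, `cos x ∂`, `sin x ∂`, the cocycle is equivariant for the copy of `sl₂`
  that these span. The Casimir element of `sl₂` is `2` on `Vect(S¹)` and `K (K + 1)` on leading
  terms of order `K`, so there are no leading terms of order `K > 1` above this bound.
* The coefficient of `ξ^k` in `c(f ∂)` at a point `p` depends only on a finite jet of `f` at `p`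
  (`exists_forall_ev_coeff_eq_zero`). Put `s = 1 - cos (x - p)` and let `f` vanish at `p` to order
  `4 r`. Then `f = s^(2r) g` with `g` smooth on the circle, and `g` is a constant plus a derivative
  `G'`. As `[s^r ∂, s^r G ∂] = s^(2r) G' ∂` and `[s^r cos ∂, s^r sin ∂] = s^(2r) ∂`
  (with `cos`, `sin` taken at `x - p`), the field `f ∂` is a sum of brackets of fields that vanish
  to order `2 r` at `p`, and the cocycle condition makes the coefficient vanish at `p` when `r` is
  large.
* Subtracting a coboundary, one can assume that `c(∂)` has constant coefficients. The cocycle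
  condition for `∂` and `f ∂` then shows that the differential operators have constant coefficients
  (`exists_constant_coefficients`): their coefficients have constant, hence zero, derivative.

What remains is algebra. Write `c(f ∂) = ∑ a_{k,j} f^(j) ξ^k` and `w = k + j - 1`. Comparing the
coefficients of `f' g^(j)` in the cocycle condition gives `w a_{k,j} = (w choose j) a_{w,1}`. Thus
the part with `w ≠ 0` is the coboundary of `-∑ (a_{w,1} / w) ξ^w`, except for the terms with `j =
0`: these vanish for `k ≠ 0`, and `a_{0,0} f` is a multiple of `θ₀`. The part with `w = 0` is a
cocycle `∑ a_n f^(n) ξ^(1-n)`; the coefficients of `f'' g^(j)` give a recursion that determines it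
from `a_1`, `a_2`, `a_3`, the coordinates along `θ₁`, `θ₂`, `θ₃`. That these are cocycles comes
down to two identities between binomial coefficients, for the sequences `(-1)^(n-1)` and
`(-1)^(n-1) / n` (`rationalSeq_mem`). Independence of the four classes is read off from the values
at `∂` and the coefficients of `f'`, `f'' ξ^(-1)`, `f''' ξ^(-2)`.
-/

noncomputable section

namespace PseudoDiff

variable {𝕜 : Type*} [RCLike 𝕜]

/-! ### Jets of functions on the circle -/

/-- Evaluation of a function on the circle at the point `p`. -/
def ev (p : ℝ) : smoothCircle 𝕜 →ₐ[𝕜] 𝕜 :=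
  (Pi.evalAlgHom 𝕜 (fun _ : ℝ => 𝕜) p).comp (smoothCircle 𝕜).val

theorem ev_apply (p : ℝ) (f : smoothCircle 𝕜) : ev p f = f.1 p := rfl

theorem ext_ev {f g : smoothCircle 𝕜} (h : ∀ p, ev p f = ev p g) : f = g :=
  Subtype.ext (funext h)

/-- The `j`-th derivative at the point `p`. -/
def jet (p : ℝ) (j : ℕ) : smoothCircle 𝕜 →ₗ[𝕜] 𝕜 where
  toFun f := ev p ((ddx 𝕜)^[j] f)
  map_add' f g := by rw [ddx_iterate_add, map_add]
  map_smul' c f := by rw [ddx_iterate_smul, map_smul]; rfl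

theorem jet_apply (p : ℝ) (j : ℕ) (f : smoothCircle 𝕜) : jet p j f = ev p ((ddx 𝕜)^[j] f) := rfl

theorem jet_zero (p : ℝ) (f : smoothCircle 𝕜) : jet p 0 f = ev p f := rfl

theorem jet_ddx (p : ℝ) (j : ℕ) (f : smoothCircle 𝕜) : jet p j (ddx 𝕜 f) = jet p (j + 1) f := rfl

theorem jet_mul (p : ℝ) (n : ℕ) (f g : smoothCircle 𝕜) :
    jet p n (f * g) = ∑ q ∈ Finset.HasAntidiagonal.antidiagonal n,
      (n.choose q.1 : 𝕜) * (jet p q.1 f * jet p q.2 g) := by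
  simp [jet_apply, ddx_iterate_mul]

theorem hasDerivAt_coe (f : smoothCircle 𝕜) (x : ℝ) : HasDerivAt f.1 ((ddx 𝕜 f).1 x) x :=
  (f.2.1.differentiable (by simp) x).hasDerivAt

theorem ddx_eq_of_hasDerivAt {f g : smoothCircle 𝕜} (h : ∀ x, HasDerivAt f.1 (g.1 x) x) :
    ddx 𝕜 f = g := Subtype.ext (funext fun x => (h x).deriv)

theorem continuous_coe (f : smoothCircle 𝕜) : Continuous f.1 := f.2.1.continuous

theorem iteratedDeriv_coe (f : smoothCircle 𝕜) (n : ℕ) :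
    iteratedDeriv n f.1 = ((ddx 𝕜)^[n] f).1 := by
  induction n with
  | zero => rw [iteratedDeriv_zero]; rfl
  | succ n ih => rw [iteratedDeriv_succ, ih, Function.iterate_succ_apply']; rfl

/-! ### Primitives -/

/-- The integral of a function over the circle. -/
def circleInt : smoothCircle 𝕜 →ₗ[𝕜] 𝕜 where
  toFun f := ∫ x in (0 : ℝ)..2 * Real.pi, f.1 x
  map_add' f g := intervalIntegral.integral_add (f.2.1.continuous.intervalIntegrable _ _)
    (g.2.1.continuous.intervalIntegrable _ _)
  map_smul' c _ := intervalIntegral.integral_const_mul c _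

theorem circleInt_apply (f : smoothCircle 𝕜) :
    circleInt f = ∫ x in (0 : ℝ)..2 * Real.pi, f.1 x := rfl

theorem circleInt_ddx (f : smoothCircle 𝕜) : circleInt (ddx 𝕜 f) = 0 := by
  rw [circleInt_apply, intervalIntegral.integral_eq_sub_of_hasDerivAt
    (fun x _ => hasDerivAt_coe f x) ((continuous_coe _).intervalIntegrable _ _)]
  have := f.2.2 0
  rw [zero_add] at this
  rw [this, sub_self]

theorem circleInt_one : circleInt (1 : smoothCircle 𝕜) = ((2 * Real.pi : ℝ) : 𝕜) := by
  rw [circleInt_apply]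
  change ∫ x in (0 : ℝ)..2 * Real.pi, (1 : 𝕜) = _
  rw [intervalIntegral.integral_const, sub_zero, RCLike.real_smul_eq_coe_mul, mul_one]

theorem circleInt_one_ne_zero : circleInt (1 : smoothCircle 𝕜) ≠ 0 := by
  rw [circleInt_one]
  exact_mod_cast Real.two_pi_pos.ne'

theorem exists_ddx_eq_of_circleInt_eq_zero (f : smoothCircle 𝕜) (hf : circleInt f = 0) :
    ∃ g, ddx 𝕜 g = f := by
  have hd : ∀ x, HasDerivAt (fun y => ∫ t in (0 : ℝ)..y, f.1 t) (f.1 x) x := fun x =>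
    intervalIntegral.integral_hasDerivAt_right ((continuous_coe f).intervalIntegrable _ _)
      ((continuous_coe f).stronglyMeasurableAtFilter _ _) (continuous_coe f).continuousAt
  refine ⟨⟨fun y => ∫ t in (0 : ℝ)..y, f.1 t, ?_, ?_⟩, ddx_eq_of_hasDerivAt hd⟩
  · refine contDiff_infty_iff_deriv.2 ⟨fun x => (hd x).differentiableAt, ?_⟩
    rw [show deriv (fun y => ∫ t in (0 : ℝ)..y, f.1 t) = f.1 from funext fun x => (hd x).deriv]
    exact f.2.1
  · intro y
    have h := f.2.2.intervalIntegral_add_eq y 0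
    rw [zero_add, ← circleInt_apply, hf] at h
    dsimp only
    rw [← intervalIntegral.integral_add_adjacent_intervals
      ((continuous_coe f).intervalIntegrable 0 y)
      ((continuous_coe f).intervalIntegrable y (y + 2 * Real.pi)), h, add_zero]

/-- A smooth function on the circle is a constant plus a derivative. -/
theorem exists_eq_const_add_ddx (f : smoothCircle 𝕜) :
    ∃ (c : 𝕜) (g : smoothCircle 𝕜), f = c • 1 + ddx 𝕜 g := by
  obtain ⟨g, hg⟩ := exists_ddx_eq_of_circleInt_eq_zero
    (f - (circleInt f / circleInt (1 : smoothCircle 𝕜)) • 1) (by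
      rw [map_sub, map_smul, smul_eq_mul, div_mul_cancel₀ _ circleInt_one_ne_zero, sub_self])
  exact ⟨_, g, by rw [hg, add_sub_cancel]⟩

/-- A constant that is a derivative on the circle vanishes. -/
theorem const_eq_zero_of_ddx_eq {g : smoothCircle 𝕜} {c : 𝕜} (h : ddx 𝕜 g = c • 1) : c = 0 := by
  have h1 := circleInt_ddx g
  rw [h, map_smul, smul_eq_mul] at h1
  exact (mul_eq_zero.1 h1).resolve_right circleInt_one_ne_zero

theorem eq_const_of_ddx_eq_zero {f : smoothCircle 𝕜} (h : ddx 𝕜 f = 0) : f = ev 0 f • 1 := by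
  refine ext_ev fun p => ?_
  rw [map_smul, map_one, smul_eq_mul, mul_one]
  refine is_const_of_deriv_eq_zero (f.2.1.differentiable (by simp)) (fun x => ?_) p 0
  exact congrFun (congrArg Subtype.val h) x

theorem ddx_const (c : 𝕜) : ddx 𝕜 (c • (1 : smoothCircle 𝕜)) = 0 := by
  rw [Derivation.map_smul, Derivation.map_one_eq_zero, smul_zero]

/-! ### Trigonometric functions and jets -/

/-- The function `sin (x - p)` on the circle. -/
def sinAt (𝕜 : Type*) [RCLike 𝕜] (p : ℝ) : smoothCircle 𝕜 :=
  ⟨fun x => (Real.sin (x - p) : 𝕜), (RCLike.ofRealCLM (K := 𝕜)).contDiff.comp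
    (show ContDiff ℝ ∞ fun x => Real.sin (x - p) by fun_prop), fun x => by
      dsimp only
      rw [add_sub_right_comm, Real.sin_add_two_pi]⟩

/-- The function `cos (x - p)` on the circle. -/
def cosAt (𝕜 : Type*) [RCLike 𝕜] (p : ℝ) : smoothCircle 𝕜 :=
  ⟨fun x => (Real.cos (x - p) : 𝕜), (RCLike.ofRealCLM (K := 𝕜)).contDiff.comp
    (show ContDiff ℝ ∞ fun x => Real.cos (x - p) by fun_prop), fun x => by
      dsimp only
      rw [add_sub_right_comm, Real.cos_add_two_pi]⟩

theorem ev_sinAt (p x : ℝ) : ev x (sinAt 𝕜 p) = (Real.sin (x - p) : 𝕜) := rfl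

theorem ev_cosAt (p x : ℝ) : ev x (cosAt 𝕜 p) = (Real.cos (x - p) : 𝕜) := rfl

theorem ddx_sinAt (p : ℝ) : ddx 𝕜 (sinAt 𝕜 p) = cosAt 𝕜 p := by
  refine ddx_eq_of_hasDerivAt fun x => ?_
  have h := ((hasDerivAt_id x).sub_const p).sin
  simp only [id, mul_one] at h
  exact (RCLike.ofRealCLM (K := 𝕜)).hasFDerivAt.comp_hasDerivAt x h

theorem ddx_cosAt (p : ℝ) : ddx 𝕜 (cosAt 𝕜 p) = -sinAt 𝕜 p := by
  refine ddx_eq_of_hasDerivAt fun x => ?_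
  have h := ((hasDerivAt_id x).sub_const p).cos
  simp only [id, mul_one] at h
  have h2 := RCLike.ofRealCLM (K := 𝕜) |>.hasFDerivAt.comp_hasDerivAt x h
  rw [map_neg] at h2
  exact h2

theorem sinAt_sq_add_cosAt_sq (p : ℝ) : sinAt 𝕜 p ^ 2 + cosAt 𝕜 p ^ 2 = 1 :=
  ext_ev fun x => by
    rw [map_add, map_pow, map_pow, ev_sinAt, ev_cosAt, map_one]
    exact_mod_cast Real.sin_sq_add_cos_sq (x - p)

theorem sinAt_eq (p : ℝ) : sinAt 𝕜 p =
    ((Real.cos p : ℝ) : 𝕜) • sinAt 𝕜 0 - ((Real.sin p : ℝ) : 𝕜) • cosAt 𝕜 0 :=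
  ext_ev fun x => by
    rw [map_sub, map_smul, map_smul, ev_sinAt, ev_sinAt, ev_cosAt, Real.sin_sub, sub_zero,
      smul_eq_mul, smul_eq_mul]
    push_cast
    ring

/-- `f` vanishes to order `m` at `p`: all its derivatives of order less than `m` vanish at `p`. -/
def VanishesAt (p : ℝ) (m : ℕ) (f : smoothCircle 𝕜) : Prop := ∀ j < m, jet p j f = 0

theorem VanishesAt.mono {p : ℝ} {m n : ℕ} {f : smoothCircle 𝕜} (h : VanishesAt p m f)
    (hnm : n ≤ m) : VanishesAt p n f := fun j hj => h j (hj.trans_le hnm)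

theorem VanishesAt.mul {p : ℝ} {m n : ℕ} {f g : smoothCircle 𝕜} (hf : VanishesAt p m f)
    (hg : VanishesAt p n g) : VanishesAt p (m + n) (f * g) := by
  intro j hj
  rw [jet_mul]
  refine Finset.sum_eq_zero fun q hq => ?_
  rw [Finset.HasAntidiagonal.mem_antidiagonal] at hq
  rcases lt_or_ge q.1 m with h | h
  · rw [hf _ h, zero_mul, mul_zero]
  · rw [hg q.2 (by omega), mul_zero, mul_zero]

theorem vanishesAt_zero (p : ℝ) (f : smoothCircle 𝕜) : VanishesAt p 0 f :=
  fun j hj => absurd hj (Nat.not_lt_zero j)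

theorem VanishesAt.mul_right {p : ℝ} {m : ℕ} {f : smoothCircle 𝕜} (hf : VanishesAt p m f)
    (g : smoothCircle 𝕜) : VanishesAt p m (f * g) := hf.mul (vanishesAt_zero p g)

theorem VanishesAt.pow {p : ℝ} {m : ℕ} {f : smoothCircle 𝕜} (hf : VanishesAt p m f) (n : ℕ) :
    VanishesAt p (n * m) (f ^ n) := by
  induction n with
  | zero => rw [Nat.zero_mul]; exact vanishesAt_zero _ _
  | succ n ih => rw [Nat.succ_mul, pow_succ]; exact ih.mul hf

theorem jet_mul_of_vanishesAt {p : ℝ} {m n : ℕ} {f g : smoothCircle 𝕜} (hf : VanishesAt p m f)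
    (hg : VanishesAt p n g) :
    jet p (m + n) (f * g) = ((m + n).choose m : 𝕜) * (jet p m f * jet p n g) := by
  rw [jet_mul, Finset.sum_eq_single (m, n)]
  · intro q hq hne
    rw [Finset.HasAntidiagonal.mem_antidiagonal] at hq
    rcases lt_or_ge q.1 m with h | h
    · rw [hf _ h, zero_mul, mul_zero]
    · have : q.2 < n := by
        by_contra h'
        exact hne (Prod.ext (by dsimp only; omega) (by dsimp only; omega))
      rw [hg _ this, mul_zero, mul_zero]
  · intro h
    exact (h (Finset.HasAntidiagonal.mem_antidiagonal.2 rfl)).elim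

theorem vanishesAt_sinAt (p : ℝ) : VanishesAt p 1 (sinAt 𝕜 p) := by
  intro j hj
  obtain rfl : j = 0 := by omega
  rw [jet_zero, ev_sinAt, sub_self, Real.sin_zero, RCLike.ofReal_zero]

theorem jet_sinAt_pow_self (p : ℝ) (n : ℕ) : jet p n (sinAt 𝕜 p ^ n) = (n.factorial : 𝕜) := by
  induction n with
  | zero => rw [pow_zero, jet_zero, map_one, Nat.factorial_zero, Nat.cast_one]
  | succ n ih =>
    have h := (vanishesAt_sinAt (𝕜 := 𝕜) p).pow n
    rw [Nat.mul_one] at h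
    rw [pow_succ, jet_mul_of_vanishesAt h (vanishesAt_sinAt p), ih, ← jet_ddx, ddx_sinAt,
      jet_zero, ev_cosAt, sub_self, Real.cos_zero, Nat.choose_succ_self_right, Nat.factorial_succ]
    simp

/-- The jets of `sin (x - p) ^ i` at `p` do not depend on `p`. -/
theorem jet_sinAt_pow (p : ℝ) (i j : ℕ) :
    jet p j (sinAt 𝕜 p ^ i) = jet 0 j (sinAt 𝕜 0 ^ i) := by
  have h : ∀ j, ∀ f g : smoothCircle 𝕜, (∀ x, g.1 x = f.1 (x - p)) →
      ∀ x, ((ddx 𝕜)^[j] g).1 x = ((ddx 𝕜)^[j] f).1 (x - p) := by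
    intro j
    induction j with
    | zero => exact fun f g h => h
    | succ j ih =>
      intro f g h
      rw [Function.iterate_succ_apply, Function.iterate_succ_apply]
      refine ih _ _ fun x => ?_
      rw [ddx_apply, ddx_apply, ← deriv_comp_sub_const, ← funext h]
  have h1 := h j (sinAt 𝕜 0 ^ i) (sinAt 𝕜 p ^ i) (fun x => by
    change (sinAt 𝕜 p).1 x ^ i = (sinAt 𝕜 0).1 (x - p) ^ i
    simp [sinAt]) p
  rw [sub_self] at h1
  exact h1

/-- Any jet of finite order is the jet at `p` of a polynomial in `sin (x - p)` whose coefficients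
do not depend on `p`. -/
theorem exists_jet_eq (M : ℕ) (v : ℕ → 𝕜) : ∃ t : ℕ → 𝕜, ∀ p, ∀ j < M,
    jet p j (∑ i ∈ Finset.range M, t i • sinAt 𝕜 p ^ i) = v j := by
  induction M with
  | zero => exact ⟨0, fun p j hj => absurd hj (Nat.not_lt_zero j)⟩
  | succ M ih =>
    obtain ⟨t, ht⟩ := ih
    have hM : ((M.factorial : ℕ) : 𝕜) ≠ 0 := by exact_mod_cast M.factorial_ne_zero
    set r := (v M - jet 0 M (∑ i ∈ Finset.range M, t i • sinAt 𝕜 0 ^ i)) / M.factorial with hr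
    have e : ∀ p, ∑ i ∈ Finset.range (M + 1), (Function.update t M r) i • sinAt 𝕜 p ^ i =
        ∑ i ∈ Finset.range M, t i • sinAt 𝕜 p ^ i + r • sinAt 𝕜 p ^ M := by
      intro p
      rw [Finset.sum_range_succ, Function.update_self]
      congr 1
      refine Finset.sum_congr rfl fun i hi => ?_
      rw [Function.update_of_ne (Finset.mem_range.1 hi).ne]
    refine ⟨Function.update t M r, fun p j hj => ?_⟩
    rw [e, map_add, map_smul]
    rcases Nat.lt_succ_iff_lt_or_eq.1 hj with h | rfl
    · have h0 := (vanishesAt_sinAt (𝕜 := 𝕜) p).pow M j (by omega)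
      rw [ht p j h, h0, smul_zero, add_zero]
    · rw [jet_sinAt_pow_self, map_sum]
      simp_rw [map_smul, jet_sinAt_pow p]
      rw [hr, map_sum]
      simp_rw [map_smul]
      rw [smul_eq_mul, div_mul_cancel₀ _ hM, add_sub_cancel]

theorem exists_jet_eq_at (p : ℝ) (M : ℕ) (v : ℕ → 𝕜) :
    ∃ f : smoothCircle 𝕜, ∀ j < M, jet p j f = v j :=
  let ⟨_, ht⟩ := exists_jet_eq M v
  ⟨_, ht p⟩

/-! ### Division by a function with a double zero -/

theorem exists_norm_le (f : smoothCircle 𝕜) : ∃ C, ∀ x, ‖f.1 x‖ ≤ C := by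
  obtain ⟨C, hC⟩ := (isCompact_Icc (a := (0 : ℝ)) (b := 2 * Real.pi)).exists_bound_of_continuousOn
    (continuous_coe f).continuousOn
  refine ⟨C, fun x => ?_⟩
  obtain ⟨y, hy, hxy⟩ := f.2.2.exists_mem_Ico₀ Real.two_pi_pos x
  rw [hxy]
  exact hC y ⟨hy.1, hy.2.le⟩

/-- Differentiation under the integral sign multiplies the weight by `t`. -/
theorem hasDerivAt_weighted_integral (g : smoothCircle 𝕜) {w : ℝ → ℝ} (hw : Continuous w)
    (p x : ℝ) :
    HasDerivAt (fun y => ∫ t in (0 : ℝ)..1, w t • g.1 (p + t * (y - p)))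
      (∫ t in (0 : ℝ)..1, (w t * t) • (ddx 𝕜 g).1 (p + t * (x - p))) x := by
  obtain ⟨C, hC⟩ := exists_norm_le (ddx 𝕜 g)
  have hg := continuous_coe g
  have hg' := continuous_coe (ddx 𝕜 g)
  have c1 : ∀ y, Continuous fun t : ℝ => w t • g.1 (p + t * (y - p)) := fun y => by fun_prop
  have c2 : Continuous fun t : ℝ => (w t * t) • (ddx 𝕜 g).1 (p + t * (x - p)) := by fun_prop
  have c3 : Continuous fun t : ℝ => |w t * t| * C := by fun_prop
  refine (intervalIntegral.hasDerivAt_integral_of_dominated_loc_of_deriv_le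
    (F := fun y t => w t • g.1 (p + t * (y - p)))
    (F' := fun y t => (w t * t) • (ddx 𝕜 g).1 (p + t * (y - p)))
    (bound := fun t => |w t * t| * C) (s := Set.univ) Filter.univ_mem
    (Filter.Eventually.of_forall fun y => (c1 y).aestronglyMeasurable)
    ((c1 x).intervalIntegrable _ _) c2.aestronglyMeasurable ?_
    (c3.intervalIntegrable _ _) ?_).2
  · refine Filter.Eventually.of_forall fun t _ y _ => ?_
    rw [norm_smul, Real.norm_eq_abs]
    exact mul_le_mul_of_nonneg_left (hC _) (abs_nonneg _)
  · refine Filter.Eventually.of_forall fun t _ y _ => ?_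
    have h1 : HasDerivAt (fun y => p + t * (y - p)) t y := by
      simpa using (((hasDerivAt_id y).sub_const p).const_mul t).const_add p
    have h2 := ((hasDerivAt_coe g (p + t * (y - p))).scomp y h1).const_smul (w t)
    rw [smul_smul] at h2
    exact h2

theorem contDiff_weighted_integral (g : smoothCircle 𝕜) {w : ℝ → ℝ} (hw : Continuous w) (p : ℝ) :
    ContDiff ℝ ∞ fun y => ∫ t in (0 : ℝ)..1, w t • g.1 (p + t * (y - p)) := by
  refine contDiff_infty.2 fun n => ?_
  induction n generalizing g w with
  | zero =>
    exact contDiff_zero.2 (continuous_iff_continuousAt.2 fun x =>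
      (hasDerivAt_weighted_integral g hw p x).continuousAt)
  | succ n ih =>
    rw [Nat.cast_add, Nat.cast_one, contDiff_succ_iff_deriv]
    refine ⟨fun x => (hasDerivAt_weighted_integral g hw p x).differentiableAt, by simp, ?_⟩
    rw [funext fun x => (hasDerivAt_weighted_integral g hw p x).deriv]
    exact ih (ddx 𝕜 g) (hw.mul continuous_id)

/-- **Hadamard's lemma**: a function that vanishes to order `n + 1` at `p` is `(x - p) ^ (n + 1)`
times a smooth function. -/
theorem VanishesAt.exists_eq_pow_smul {p : ℝ} {n : ℕ} {f : smoothCircle 𝕜}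
    (hf : VanishesAt p (n + 1) f) :
    ∃ q : ℝ → 𝕜, ContDiff ℝ ∞ q ∧ (∀ x, f.1 x = (x - p) ^ (n + 1) • q x) ∧
      q p = (∫ t in (0 : ℝ)..1, (1 - t) ^ n / n.factorial) • jet p (n + 1) f := by
  have hw : Continuous fun t : ℝ => (1 - t) ^ n / (n.factorial : ℝ) := by fun_prop
  refine ⟨_, contDiff_weighted_integral ((ddx 𝕜)^[n + 1] f) hw p, fun x => ?_, ?_⟩
  · have hT := taylor_integral_remainder (f := f.1) (x := x) (x₀ := p) (n := n)
      (f.2.1.of_le (by exact_mod_cast le_top)).contDiffOn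
    rcases eq_or_ne p x with rfl | hne
    · rw [sub_self, zero_pow (by omega), zero_smul]
      exact hf 0 (by omega)
    have hU : UniqueDiffOn ℝ (Set.uIcc p x) := uniqueDiffOn_uIcc hne
    have hD : ∀ k, ∀ t ∈ Set.uIcc p x,
        iteratedDerivWithin k f.1 (Set.uIcc p x) t = ((ddx 𝕜)^[k] f).1 t := by
      intro k t ht
      rw [iteratedDerivWithin_eq_iteratedDeriv hU
        (f.2.1.of_le (by exact_mod_cast le_top)).contDiffAt ht, iteratedDeriv_coe]
    rw [taylor_within_apply, Finset.sum_eq_zero, sub_zero] at hT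
    · rw [hT, pow_succ, mul_smul]
      have e := intervalIntegral.smul_integral_comp_add_mul (a := 0) (b := 1)
        (fun t => ((x - t) ^ n / n.factorial : ℝ) • ((ddx 𝕜)^[n + 1] f).1 t) (x - p) p
      rw [mul_zero, add_zero, mul_one, add_sub_cancel] at e
      have e' : ∫ t in p..x, ((x - t) ^ n / n.factorial : ℝ) •
            iteratedDerivWithin (n + 1) f.1 (Set.uIcc p x) t =
          ∫ t in p..x, ((x - t) ^ n / n.factorial : ℝ) • ((ddx 𝕜)^[n + 1] f).1 t :=
        intervalIntegral.integral_congr fun t ht => by rw [hD _ t ht]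
      rw [e', ← e, smul_comm]
      congr 1
      rw [← intervalIntegral.integral_smul]
      refine intervalIntegral.integral_congr fun t _ => ?_
      rw [smul_smul, mul_comm (x - p) t]
      congr 1
      rw [show x - (p + t * (x - p)) = (x - p) * (1 - t) by ring, mul_pow, mul_div_assoc]
    · intro k hk
      rw [hD k p Set.left_mem_uIcc]
      have := hf k (Finset.mem_range.1 hk)
      rw [jet_apply, ev_apply] at this
      rw [this, smul_zero]
  · simp only [sub_self, mul_zero, add_zero]
    exact intervalIntegral.integral_smul_const _ _

/-- The function `1 - cos (x - p)`, whose only zero on the circle is a double zero at `p`. -/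
def bumpAt (𝕜 : Type*) [RCLike 𝕜] (p : ℝ) : smoothCircle 𝕜 := 1 - cosAt 𝕜 p

theorem ev_bumpAt (p x : ℝ) : ev x (bumpAt 𝕜 p) = ((1 - Real.cos (x - p) : ℝ) : 𝕜) := by
  rw [bumpAt, map_sub, map_one, ev_cosAt]
  push_cast
  rfl

theorem ddx_bumpAt (p : ℝ) : ddx 𝕜 (bumpAt 𝕜 p) = sinAt 𝕜 p := by
  rw [bumpAt, map_sub, Derivation.map_one_eq_zero, ddx_cosAt, zero_sub, neg_neg]

theorem ev_bumpAt_eq_zero_iff {p x : ℝ} : ev x (bumpAt 𝕜 p) = 0 ↔ Real.cos (x - p) = 1 := by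
  rw [ev_bumpAt, RCLike.ofReal_eq_zero, sub_eq_zero, eq_comm]

theorem vanishesAt_bumpAt {p x : ℝ} (h : ev x (bumpAt 𝕜 p) = 0) : VanishesAt x 2 (bumpAt 𝕜 p) := by
  intro j hj
  rcases (by omega : j = 0 ∨ j = 1) with rfl | rfl
  · exact h
  · rw [← jet_ddx, jet_zero, ddx_bumpAt, ev_sinAt]
    have := Real.sin_sq_add_cos_sq (x - p)
    rw [ev_bumpAt_eq_zero_iff.1 h] at this
    have h2 : Real.sin (x - p) = 0 := by nlinarith
    rw [h2, RCLike.ofReal_zero]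

theorem vanishesAt_bumpAt_self (p : ℝ) : VanishesAt p 2 (bumpAt 𝕜 p) :=
  vanishesAt_bumpAt (by rw [ev_bumpAt_eq_zero_iff, sub_self, Real.cos_zero])

theorem jet_two_bumpAt {p x : ℝ} (h : ev x (bumpAt 𝕜 p) = 0) : jet x 2 (bumpAt 𝕜 p) = 1 := by
  rw [← jet_ddx, ddx_bumpAt, ← jet_ddx, ddx_sinAt, jet_zero, ev_cosAt,
    ev_bumpAt_eq_zero_iff.1 h, RCLike.ofReal_one]

theorem jet_eq_of_cos_eq_one {p x : ℝ} (h : Real.cos (x - p) = 1) (j : ℕ) (f : smoothCircle 𝕜) :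
    jet x j f = jet p j f := by
  obtain ⟨n, hn⟩ := (Real.cos_eq_one_iff _).1 h
  have hx : x = p + n * (2 * Real.pi) := by linarith
  rw [jet_apply, jet_apply, ev_apply, ev_apply, hx]
  exact ((ddx 𝕜)^[j] f).2.2.int_mul n p

/-- A function that vanishes at `p` to order `2 * m` is divisible by `(1 - cos (x - p)) ^ m`. -/
theorem VanishesAt.exists_eq_bumpAt_pow_mul {p : ℝ} {m : ℕ} {f : smoothCircle 𝕜}
    (hf : VanishesAt p (2 * m) f) : ∃ g, f = bumpAt 𝕜 p ^ m * g := by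
  rcases Nat.eq_zero_or_pos m with rfl | hm
  · exact ⟨f, by rw [pow_zero, one_mul]⟩
  obtain ⟨n, hn⟩ : ∃ n, 2 * m = n + 1 := ⟨2 * m - 1, by omega⟩
  set s := bumpAt 𝕜 p with hs
  set C : 𝕜 := ((∫ t in (0 : ℝ)..1, (1 - t) ^ n / n.factorial : ℝ) : 𝕜) with hC
  have hhalf : (∫ t in (0 : ℝ)..1, (1 - t) ^ 1 / ((1 : ℕ).factorial : ℝ)) = 1 / 2 := by
    have : ∀ x : ℝ, HasDerivAt (fun x : ℝ => x - x ^ 2 / 2)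
        ((1 - x) ^ 1 / ((1 : ℕ).factorial : ℝ)) x := by
      intro x
      have h := (hasDerivAt_id x).sub ((hasDerivAt_pow 2 x).div_const 2)
      refine h.congr_deriv ?_
      simp
    rw [intervalIntegral.integral_eq_sub_of_hasDerivAt (fun x _ => this x)
      (Continuous.intervalIntegrable (by fun_prop) _ _)]
    norm_num
  -- at a zero of `1 - cos (x - p)` the value is the quotient of the leading Taylor coefficients
  let q : ℝ → 𝕜 := fun x => if s.1 x = 0 then C * jet x (2 * m) f / (1 / 2) ^ m else
    f.1 x / s.1 x ^ m
  have hq : ∀ x, f.1 x = s.1 x ^ m * q x := by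
    intro x
    dsimp only [q]
    split_ifs with h
    · rw [h, zero_pow hm.ne', zero_mul]
      have := jet_eq_of_cos_eq_one (ev_bumpAt_eq_zero_iff.1 h) 0 f
      rw [hf 0 (by omega)] at this
      exact this
    · rw [mul_div_cancel₀ _ (pow_ne_zero m h)]
  refine ⟨⟨q, ?_, ?_⟩, ext_ev fun x => ?_⟩
  · refine contDiff_iff_contDiffAt.2 fun x => ?_
    by_cases h : s.1 x = 0
    · have hx : VanishesAt x (n + 1) f := by
        intro j hj
        rw [jet_eq_of_cos_eq_one (ev_bumpAt_eq_zero_iff.1 h)]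
        exact hf j (by omega)
      obtain ⟨u, hu, hfu, hux⟩ := hx.exists_eq_pow_smul
      obtain ⟨v, hv, hsv, hvx⟩ := (vanishesAt_bumpAt h).exists_eq_pow_smul
      rw [hhalf, jet_two_bumpAt h, RCLike.real_smul_eq_coe_mul, mul_one] at hvx
      have hvx0 : v x ≠ 0 := by rw [hvx]; simp
      have hev : ∀ᶠ y in nhds x, v y ≠ 0 :=
        hv.continuous.continuousAt.eventually_ne hvx0
      have : q =ᶠ[nhds x] fun y => u y * (v y ^ m)⁻¹ := by
        filter_upwards [hev] with y hy
        rw [← div_eq_mul_inv]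
        rcases eq_or_ne y x with rfl | hyx
        · dsimp only [q]
          rw [if_pos h, hux, hvx, hn, RCLike.real_smul_eq_coe_mul]
          push_cast
          rfl
        · have hs0 : s.1 y ≠ 0 := by
            rw [hsv]
            exact smul_ne_zero (pow_ne_zero _ (sub_ne_zero.2 hyx)) hy
          dsimp only [q]
          rw [if_neg hs0, hfu, hsv, RCLike.real_smul_eq_coe_mul, RCLike.real_smul_eq_coe_mul,
            mul_pow, ← hn, pow_mul]
          have h1 : ((y - x : ℝ) : 𝕜) ≠ 0 := by exact_mod_cast sub_ne_zero.2 hyx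
          push_cast at h1 ⊢
          have h2 := pow_ne_zero m (pow_ne_zero 2 h1)
          rw [mul_div_mul_left _ _ h2]
      exact (hu.contDiffAt.mul
        ((hv.contDiffAt.pow m).inv (pow_ne_zero m hvx0))).congr_of_eventuallyEq this
    · have : q =ᶠ[nhds x] fun y => f.1 y * (s.1 y ^ m)⁻¹ := by
        filter_upwards [(continuous_coe s).continuousAt.eventually_ne h] with y hy
        rw [← div_eq_mul_inv]
        exact if_neg hy
      exact (f.2.1.contDiffAt.mul
        ((s.2.1.contDiffAt.pow m).inv (pow_ne_zero m h))).congr_of_eventuallyEq this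
  · intro x
    dsimp only [q]
    rw [s.2.2 x, f.2.2 x, jet_eq_of_cos_eq_one (by rw [add_sub_cancel_left, Real.cos_two_pi])]
  · rw [map_mul, map_pow]
    exact hq x

/-- A function that vanishes at `p` to order `4 * r` is, up to a multiple of one such commutator,
the coefficient of a commutator of vector fields vanishing at `p` to order `2 * r`. -/
theorem VanishesAt.exists_eq_bracket {p : ℝ} {r : ℕ} {f : smoothCircle 𝕜}
    (hf : VanishesAt p (4 * r) f) :
    ∃ (a b a' b' : smoothCircle 𝕜), VanishesAt p (2 * r) a ∧ VanishesAt p (2 * r) b ∧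
      VanishesAt p (2 * r) a' ∧ VanishesAt p (2 * r) b' ∧
      f = (a * ddx 𝕜 b - ddx 𝕜 a * b) + (a' * ddx 𝕜 b' - ddx 𝕜 a' * b') := by
  have hs := (vanishesAt_bumpAt_self (𝕜 := 𝕜) p).pow r
  rw [mul_comm] at hs
  obtain ⟨g, rfl⟩ := VanishesAt.exists_eq_bumpAt_pow_mul (m := 2 * r)
    (hf.mono (by omega))
  obtain ⟨c, G, rfl⟩ := exists_eq_const_add_ddx g
  set S := bumpAt 𝕜 p ^ r with hS
  refine ⟨S, S * G, S * (c • cosAt 𝕜 p), S * sinAt 𝕜 p, hs, hs.mul_right _, hs.mul_right _,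
    hs.mul_right _, ?_⟩
  have h1 := sinAt_sq_add_cosAt_sq (𝕜 := 𝕜) p
  simp only [Derivation.leibniz, smul_eq_mul, Derivation.map_smul, ddx_sinAt, ddx_cosAt]
  rw [mul_comm 2 r, pow_mul, ← hS]
  simp only [Algebra.smul_def]
  linear_combination (-S ^ 2 * algebraMap 𝕜 (smoothCircle 𝕜) c) * h1

/-! ### The action of vector fields on symbols -/

/-- The vector field `f ∂`. -/
def field (f : smoothCircle 𝕜) : VectS1 𝕜 := (VectS1.coeff 𝕜).symm f

@[simp]
theorem coeff_field (f : smoothCircle 𝕜) : VectS1.coeff 𝕜 (field f) = f := rfl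

theorem field_add (f g : smoothCircle 𝕜) : field (f + g) = field f + field g := rfl

theorem lie_field (f g : smoothCircle 𝕜) :
    ⁅field f, field g⁆ = field (f * ddx 𝕜 g - ddx 𝕜 f * g) := rfl

theorem coeff_mul_monomial (F : PsiD 𝕜) (i m : ℤ) (g : smoothCircle 𝕜) {K : ℕ}
    (hF : ∀ j, m - i + K ≤ j → F.coeff j = 0) :
    (F * PsiD.monomial i g).coeff m = ∑ n ∈ Finset.range K,
      Ring.choose (m - i + n) n • (F.coeff (m - i + n) * (ddx 𝕜)^[n] g) := by
  have e : ∑ n ∈ Finset.range K,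
      Ring.choose (m - i + n) n • (F.coeff (m - i + n) * (ddx 𝕜)^[n] g) =
      ∑ p ∈ (Finset.range K).image (fun n : ℕ => (m - i + (n : ℤ), n)),
        PsiD.mulTerm F (PsiD.monomial i g) m p := by
    rw [Finset.sum_image fun a _ b _ h => (Prod.ext_iff.1 h).2]
    refine Finset.sum_congr rfl fun n _ => ?_
    have : m - (m - i + (n : ℤ) - n) = i := by ring
    rw [PsiD.mulTerm, this, PsiD.coeff_monomial, if_pos rfl]
  rw [PsiD.coeff_mul, e]
  refine finsum_eq_sum_of_support_subset _ fun p hp => ?_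
  rw [Function.mem_support, PsiD.mulTerm, PsiD.coeff_monomial] at hp
  have h1 : m - (p.1 - (p.2 : ℤ)) = i := by
    by_contra h
    rw [if_neg h, ddx_iterate_zero, mul_zero, smul_zero] at hp
    exact hp rfl
  have h2 : p.2 < K := by
    by_contra h
    rw [hF p.1 (by omega), zero_mul, smul_zero] at hp
    exact hp rfl
  rw [Finset.mem_coe, Finset.mem_image]
  exact ⟨p.2, Finset.mem_range.2 h2, Prod.ext (by dsimp only; omega) rfl⟩

/-- The coefficients of `f ∂ · F`; the number `M` of correction terms is any number that exhausts
the order of `F`. -/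
theorem coeff_lie_symbol (X : VectS1 𝕜) (F : PsiD 𝕜) (k : ℤ) (M : ℕ)
    (hF : ∀ j, k + M ≤ j → F.coeff j = 0) :
    (⁅X, F⁆ : PsiD 𝕜).coeff k = VectS1.coeff 𝕜 X * ddx 𝕜 (F.coeff k) -
      ∑ n ∈ Finset.range M, Ring.choose (k + n) (n + 1) •
        ((ddx 𝕜)^[n + 1] (VectS1.coeff 𝕜 X) * F.coeff (k + n)) := by
  have h1 : stdEmbedding 𝕜 X = PsiD.monomial 1 (VectS1.coeff 𝕜 X) := rfl
  rw [lie_def, PsiD.coeff_sub, h1, PsiD.coeff_monomial_one_mul,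
    coeff_mul_monomial (K := M + 1) F 1 k _ (fun j hj => hF j (by push_cast at hj; omega)),
    Finset.sum_range_succ']
  have h2 : ∀ n : ℕ, k - 1 + ((n + 1 : ℕ) : ℤ) = k + n := fun n => by push_cast; ring
  simp only [h2, Nat.cast_zero, add_zero, Ring.choose_zero_right, one_smul,
    Function.iterate_zero, id]
  simp_rw [mul_comm (F.coeff _)]
  ring

/-- The symbols of order at most `N`. -/
def orderLE (𝕜 : Type*) [RCLike 𝕜] (N : ℤ) : Submodule 𝕜 (PsiD 𝕜) where
  carrier := {F | ∀ k, N < k → F.coeff k = 0}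
  add_mem' := fun hF hG k hk => by rw [PsiD.coeff_add, hF k hk, hG k hk, add_zero]
  zero_mem' := fun _ _ => rfl
  smul_mem' := fun c _ hF k hk => by rw [PsiD.coeff_smul, hF k hk, smul_zero]

theorem orderLE_mono {N M : ℤ} (h : N ≤ M) : orderLE 𝕜 N ≤ orderLE 𝕜 M :=
  fun _ hF k hk => hF k (h.trans_lt hk)

theorem exists_mem_orderLE (F : PsiD 𝕜) : ∃ N, F ∈ orderLE 𝕜 N := F.2

theorem lie_mem_orderLE {N : ℤ} (X : VectS1 𝕜) {F : PsiD 𝕜} (hF : F ∈ orderLE 𝕜 N) :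
    ⁅X, F⁆ ∈ orderLE 𝕜 N := fun k hk => by
  rw [coeff_lie_symbol X F k 0 (fun j hj => hF j (by push_cast at hj; omega)), hF k hk, map_zero,
    mul_zero, Finset.sum_range_zero, sub_zero]

/-- On leading coefficients `f ∂` acts by the Lie derivative of densities. -/
theorem coeff_lie_of_mem_orderLE {N : ℤ} (X : VectS1 𝕜) {F : PsiD 𝕜} (hF : F ∈ orderLE 𝕜 N) :
    (⁅X, F⁆ : PsiD 𝕜).coeff N = VectS1.coeff 𝕜 X * ddx 𝕜 (F.coeff N) -
      N • (ddx 𝕜 (VectS1.coeff 𝕜 X) * F.coeff N) := by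
  rw [coeff_lie_symbol X F N 1 (fun j hj => hF j (by push_cast at hj; omega))]
  simp

theorem ddx_iterate_succ_one (n : ℕ) : (ddx 𝕜)^[n + 1] (1 : smoothCircle 𝕜) = 0 :=
  PsiD.ddx_iterate_one _ n.succ_ne_zero

theorem coeff_field_one_lie (F : PsiD 𝕜) (k : ℤ) :
    (⁅field (1 : smoothCircle 𝕜), F⁆ : PsiD 𝕜).coeff k = ddx 𝕜 (F.coeff k) := by
  obtain ⟨N, hN⟩ := exists_mem_orderLE F
  rw [coeff_lie_symbol (field 1) F k (N + 1 - k).toNat (fun j hj => hN j (by omega)),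
    Finset.sum_eq_zero fun n _ => by rw [coeff_field, ddx_iterate_succ_one, zero_mul, smul_zero],
    sub_zero, coeff_field, one_mul]

/-- The coefficient of `f ∂ · F` at `p` involves only finitely many derivatives of `f` at `p`. -/
theorem ev_coeff_lie_eq_zero {N : ℤ} {F : PsiD 𝕜} (hF : F ∈ orderLE 𝕜 N) {k : ℤ} {m : ℕ} {p : ℝ}
    {f : smoothCircle 𝕜} (hf : VanishesAt p m f) (hm : 1 ≤ m) (hk : N + 2 - k ≤ m) :
    ev p ((⁅field f, F⁆ : PsiD 𝕜).coeff k) = 0 := by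
  rw [coeff_lie_symbol (field f) F k (N + 1 - k).toNat (fun j hj => hF j (by omega)), map_sub,
    map_mul, coeff_field, ← jet_zero, hf 0 hm, zero_mul, zero_sub, neg_eq_zero, map_sum]
  refine Finset.sum_eq_zero fun n hn => ?_
  rw [Finset.mem_range] at hn
  have := hf (n + 1) (by omega)
  rw [jet_apply] at this
  rw [map_zsmul, map_mul, this, zero_mul, smul_zero]

/-! ### Cocycles have bounded order -/

/-- The Casimir element of the Lie algebra spanned by `∂`, `cos x ∂`, `sin x ∂` acts on `Vect(S¹)`
by the scalar `2`. -/
theorem casimir_field (X : VectS1 𝕜) :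
    ⁅field (cosAt 𝕜 0), ⁅field (cosAt 𝕜 0), X⁆⁆ + ⁅field (sinAt 𝕜 0), ⁅field (sinAt 𝕜 0), X⁆⁆ -
      ⁅field (1 : smoothCircle 𝕜), ⁅field (1 : smoothCircle 𝕜), X⁆⁆ = (2 : 𝕜) • X := by
  apply (VectS1.coeff 𝕜).injective
  have h := sinAt_sq_add_cosAt_sq (𝕜 := 𝕜) 0
  simp only [map_sub, map_add, VectS1.coeff_lie, coeff_field, Derivation.leibniz, smul_eq_mul,
    ddx_sinAt, ddx_cosAt, Derivation.map_one_eq_zero, map_neg, map_zero, two_smul]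
  linear_combination (ddx 𝕜 (ddx 𝕜 (VectS1.coeff 𝕜 X)) + 2 * VectS1.coeff 𝕜 X) * h

/-- The Casimir element acts on densities of weight `-K` by the scalar `K (K + 1)`. -/
theorem casimir_density (K : ℤ) (L : smoothCircle 𝕜 → smoothCircle 𝕜 → smoothCircle 𝕜)
    (hL : ∀ f u, L f u = f * ddx 𝕜 u - K • (ddx 𝕜 f * u)) (u : smoothCircle 𝕜) :
    L (cosAt 𝕜 0) (L (cosAt 𝕜 0) u) + L (sinAt 𝕜 0) (L (sinAt 𝕜 0) u) - L 1 (L 1 u) =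
      (K * (K + 1)) • u := by
  have h := sinAt_sq_add_cosAt_sq (𝕜 := 𝕜) 0
  simp only [hL, map_sub, Derivation.leibniz, smul_eq_mul, ddx_sinAt, ddx_cosAt,
    Derivation.map_one_eq_zero, map_neg, map_zero, zsmul_eq_mul, Derivation.map_intCast]
  push_cast
  linear_combination (ddx 𝕜 (ddx 𝕜 u) + K * u + K ^ 2 * u) * h

open LieModule.Cohomology

/-- A cocycle takes values in symbols of bounded order: modulo the order of its values on the three
vector fields `∂`, `cos x ∂`, `sin x ∂` it intertwines the Casimir elements, whose eigenvalue
`K (K + 1)` on symbols of order `K > 1` differs from the eigenvalue `2` on `Vect(S¹)`. -/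
theorem exists_forall_mem_orderLE {c : oneCochain 𝕜 (VectS1 𝕜) (PsiD 𝕜)}
    (hc : c ∈ oneCocycles 𝕜 (VectS1 𝕜) (PsiD 𝕜)) : ∃ N, ∀ X, c X ∈ orderLE 𝕜 N := by
  rw [mem_oneCocycles_iff] at hc
  obtain ⟨N₁, h₁⟩ := exists_mem_orderLE (c (field 1))
  obtain ⟨N₂, h₂⟩ := exists_mem_orderLE (c (field (cosAt 𝕜 0)))
  obtain ⟨N₃, h₃⟩ := exists_mem_orderLE (c (field (sinAt 𝕜 0)))
  set N := max 1 (max N₁ (max N₂ N₃)) with hN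
  replace h₁ := orderLE_mono (show N₁ ≤ N by omega) h₁
  replace h₂ := orderLE_mono (show N₂ ≤ N by omega) h₂
  replace h₃ := orderLE_mono (show N₃ ≤ N by omega) h₃
  have step : ∀ K, N < K → ∀ X, c X ∈ orderLE 𝕜 K → c X ∈ orderLE 𝕜 (K - 1) := by
    intro K hK X hX k hk
    rcases (by omega : K < k ∨ k = K) with h | rfl
    · exact hX k h
    have hmem : ∀ v, c v ∈ orderLE 𝕜 N → ∀ Y, c Y ∈ orderLE 𝕜 k → c ⁅v, Y⁆ ∈ orderLE 𝕜 k := by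
      intro v hv Y hY
      rw [hc]
      exact sub_mem (lie_mem_orderLE _ hY) (lie_mem_orderLE _ (orderLE_mono hK.le hv))
    have hlie : ∀ f, c (field f) ∈ orderLE 𝕜 N → ∀ Y, c Y ∈ orderLE 𝕜 k →
        (c ⁅field f, Y⁆).coeff k =
          f * ddx 𝕜 ((c Y).coeff k) - k • (ddx 𝕜 f * (c Y).coeff k) := by
      intro f hf Y hY
      rw [hc, PsiD.coeff_sub, coeff_lie_of_mem_orderLE _ hY, lie_mem_orderLE Y hf k hK, sub_zero,
        coeff_field]
    have hcas := congrArg (fun Y => (c Y).coeff k) (casimir_field X)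
    rw [map_sub, map_add, PsiD.coeff_sub, PsiD.coeff_add, map_smul, PsiD.coeff_smul,
      hlie _ h₂ _ (hmem _ h₂ X hX), hlie _ h₂ _ hX, hlie _ h₃ _ (hmem _ h₃ X hX), hlie _ h₃ _ hX,
      hlie _ h₁ _ (hmem _ h₁ X hX), hlie _ h₁ _ hX,
      casimir_density k (fun f u => f * ddx 𝕜 u - k • (ddx 𝕜 f * u)) (fun _ _ => rfl)] at hcas
    refine ext_ev fun p => ?_
    have h2 := congrArg (ev p) hcas
    rw [map_zsmul, map_smul, zsmul_eq_mul, smul_eq_mul] at h2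
    rw [map_zero]
    have h3 : (((k - 1) * (k + 2) : ℤ) : 𝕜) * ev p ((c X).coeff k) = 0 := by
      push_cast at h2 ⊢
      linear_combination h2
    refine (mul_eq_zero.1 h3).resolve_left ?_
    exact_mod_cast mul_ne_zero (show k - 1 ≠ 0 by omega) (show k + 2 ≠ 0 by omega)
  refine ⟨N, fun X => ?_⟩
  obtain ⟨M, hM⟩ := exists_mem_orderLE (c X)
  have descend : ∀ n : ℕ, c X ∈ orderLE 𝕜 (N + n) → c X ∈ orderLE 𝕜 N := by
    intro n
    induction n with
    | zero => intro h; simpa using h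
    | succ n ih =>
      intro h
      have := step _ (by push_cast; omega) X h
      exact ih (by simpa [add_sub_assoc] using this)
  exact descend (M - N).toNat (orderLE_mono (by omega) hM)

/-! ### Cocycles are differential operators -/

/-- The coefficients of a cocycle at `p` depend on finitely many derivatives at `p`: a vector field
vanishing to high order is a sum of brackets of vector fields vanishing at `p`. -/
theorem exists_forall_ev_coeff_eq_zero {c : oneCochain 𝕜 (VectS1 𝕜) (PsiD 𝕜)}
    (hc : c ∈ oneCocycles 𝕜 (VectS1 𝕜) (PsiD 𝕜)) {N : ℤ} (hN : ∀ X, c X ∈ orderLE 𝕜 N) (k : ℤ) :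
    ∃ m, ∀ p f, VanishesAt p m f → ev p ((c (field f)).coeff k) = 0 := by
  rw [mem_oneCocycles_iff] at hc
  set r := (N + 2 - k).toNat + 1 with hr
  refine ⟨4 * r, fun p f hf => ?_⟩
  obtain ⟨a, b, a', b', ha, hb, ha', hb', rfl⟩ := hf.exists_eq_bracket
  rw [field_add, ← lie_field, ← lie_field, map_add, hc, hc, PsiD.coeff_add, PsiD.coeff_sub,
    PsiD.coeff_sub, map_add, map_sub, map_sub,
    ev_coeff_lie_eq_zero (hN _) ha (by omega) (by omega),
    ev_coeff_lie_eq_zero (hN _) hb (by omega) (by omega),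
    ev_coeff_lie_eq_zero (hN _) ha' (by omega) (by omega),
    ev_coeff_lie_eq_zero (hN _) hb' (by omega) (by omega)]
  simp

/-- The value of `T (sin (x - p) ^ i)` at `x = p` depends smoothly on `p`, whatever `T` is, by the
addition theorem. -/
theorem exists_ev_eq_ev_map_sinAt_pow (T : smoothCircle 𝕜 →ₗ[𝕜] smoothCircle 𝕜) (i : ℕ) :
    ∃ b : smoothCircle 𝕜, ∀ p, ev p b = ev p (T (sinAt 𝕜 p ^ i)) := by
  refine ⟨∑ m ∈ Finset.range (i + 1), (i.choose m : 𝕜) • (cosAt 𝕜 0 ^ m *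
    (-sinAt 𝕜 0) ^ (i - m) * T (sinAt 𝕜 0 ^ m * cosAt 𝕜 0 ^ (i - m))), fun p => ?_⟩
  have e : sinAt 𝕜 p ^ i = ∑ m ∈ Finset.range (i + 1), ((i.choose m : 𝕜) *
      (((Real.cos p : ℝ) : 𝕜) ^ m * (-((Real.sin p : ℝ) : 𝕜)) ^ (i - m))) •
        (sinAt 𝕜 0 ^ m * cosAt 𝕜 0 ^ (i - m)) := by
    rw [sinAt_eq, sub_eq_add_neg, ← neg_smul, add_pow]
    refine Finset.sum_congr rfl fun m _ => ?_
    rw [smul_pow, smul_pow, smul_mul_smul_comm, mul_comm, ← nsmul_eq_mul,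
      ← Nat.cast_smul_eq_nsmul 𝕜, smul_smul]
  rw [e, map_sum, map_sum, map_sum]
  refine Finset.sum_congr rfl fun m _ => ?_
  rw [map_smul, map_mul, map_mul, map_pow, map_pow, map_neg, map_smul, map_smul, ev_cosAt,
    ev_sinAt, sub_zero, smul_eq_mul, smul_eq_mul]
  ring

/-- A linear operator that is local on jets of order less than `m` is a differential operator with
smooth coefficients. -/
theorem exists_eq_sum_mul_ddx_iterate (T : smoothCircle 𝕜 →ₗ[𝕜] smoothCircle 𝕜) (m : ℕ)
    (hT : ∀ p f, VanishesAt p m f → ev p (T f) = 0) :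
    ∃ a : ℕ → smoothCircle 𝕜, ∀ f, T f = ∑ j ∈ Finset.range m, a j * (ddx 𝕜)^[j] f := by
  choose t ht using fun j : ℕ => exists_jet_eq (𝕜 := 𝕜) m (Pi.single j 1)
  -- the coefficients are the values of `T` at polynomials in `sin (x - p)` with unit jets at `p`
  choose b hb using exists_ev_eq_ev_map_sinAt_pow T
  refine ⟨fun j => ∑ i ∈ Finset.range m, t j i • b i, fun f => ext_ev fun p => ?_⟩
  have h1 : VanishesAt p m (f - ∑ j ∈ Finset.range m,
      jet p j f • ∑ i ∈ Finset.range m, t j i • sinAt 𝕜 p ^ i) := by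
    intro l hl
    rw [map_sub, map_sum, Finset.sum_eq_single l]
    · rw [map_smul, ht l p l hl, Pi.single_eq_same, smul_eq_mul, mul_one, sub_self]
    · intro j _ hj
      rw [map_smul, ht j p l hl, Pi.single_eq_of_ne hj.symm, smul_zero]
    · intro h
      exact absurd (Finset.mem_range.2 hl) h
  have h2 := hT p _ h1
  rw [map_sub, map_sub, sub_eq_zero] at h2
  rw [h2]
  simp only [map_sum, map_smul, map_mul, ← hb, ← jet_apply, smul_eq_mul]
  exact Finset.sum_congr rfl fun j _ => mul_comm _ _

/-- The coefficients of a differential operator are determined by the operator. -/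
theorem eq_zero_of_sum_mul_ddx_iterate_eq_zero {m : ℕ} {b : ℕ → smoothCircle 𝕜}
    (h : ∀ f, ∑ j ∈ Finset.range m, b j * (ddx 𝕜)^[j] f = 0) {j : ℕ} (hj : j < m) : b j = 0 := by
  refine ext_ev fun p => ?_
  obtain ⟨f, hf⟩ := exists_jet_eq_at p m (Pi.single j (1 : 𝕜))
  have h1 := congrArg (ev p) (h f)
  rw [map_sum, Finset.sum_eq_single j] at h1
  · rw [map_mul, ← jet_apply, hf j hj, Pi.single_eq_same, mul_one] at h1
    exact h1
  · intro l hl hne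
    rw [map_mul, ← jet_apply, hf l (Finset.mem_range.1 hl), Pi.single_eq_of_ne hne, mul_zero]
  · intro h'
    exact absurd (Finset.mem_range.2 hj) h'

/-- The coefficient of `ξ ^ k`, as a linear map. -/
def coeffMap (k : ℤ) : PsiD 𝕜 →ₗ[𝕜] smoothCircle 𝕜 where
  toFun F := F.coeff k
  map_add' _ _ := rfl
  map_smul' _ _ := rfl

/-- Each coefficient of a cocycle is a differential operator; one that has constant coefficients,
as soon as the value of the cocycle at `∂` is constant. -/
theorem exists_constant_coefficients {c : oneCochain 𝕜 (VectS1 𝕜) (PsiD 𝕜)}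
    (hc : c ∈ oneCocycles 𝕜 (VectS1 𝕜) (PsiD 𝕜)) {N : ℤ} (hN : ∀ X, c X ∈ orderLE 𝕜 N)
    (h1 : ∀ k, ddx 𝕜 ((c (field 1)).coeff k) = 0) (k : ℤ) :
    ∃ (a : ℕ → 𝕜) (m : ℕ), (∀ j, m ≤ j → a j = 0) ∧ (k ≠ 0 → a 0 = 0) ∧
      ∀ f, (c (field f)).coeff k = ∑ j ∈ Finset.range m, a j • (ddx 𝕜)^[j] f := by
  obtain ⟨m₀, hm₀⟩ := exists_forall_ev_coeff_eq_zero hc hN k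
  rw [mem_oneCocycles_iff] at hc
  obtain ⟨M, hM⟩ : ∃ M, M = m₀ + (N + 1 - k).toNat + 1 := ⟨_, rfl⟩
  obtain ⟨a, ha⟩ := exists_eq_sum_mul_ddx_iterate
    ((coeffMap k).comp (c.comp (VectS1.coeff 𝕜).symm.toLinearMap)) (M + 1)
    (fun p f hf => hm₀ p f (hf.mono (by omega)))
  replace ha : ∀ f, (c (field f)).coeff k = ∑ j ∈ Finset.range (M + 1), a j * (ddx 𝕜)^[j] f := ha
  set κ : ℤ → 𝕜 := fun l => ev 0 ((c (field 1)).coeff l) with hκ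
  have hκ1 : ∀ l, (c (field 1)).coeff l = κ l • 1 := fun l => eq_const_of_ddx_eq_zero (h1 l)
  -- the cocycle condition for `∂` and `f ∂`
  have key : ∀ f, ∑ j ∈ Finset.range (M + 1), (ddx 𝕜 (a j) + if j = 0 then 0 else
      (Ring.choose (k + (j - 1 : ℕ)) j • κ (k + (j - 1 : ℕ))) • 1) * (ddx 𝕜)^[j] f = 0 := by
    intro f
    have e := congrArg (fun F => F.coeff k) (hc (field 1) (field f))
    rw [lie_field, Derivation.map_one_eq_zero, zero_mul, sub_zero, one_mul, PsiD.coeff_sub,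
      coeff_field_one_lie, ha, ha, coeff_lie_symbol (field f) _ k M
      (fun j hj => hN _ j (by push_cast [hM] at hj; omega)), h1, mul_zero, zero_sub, sub_neg_eq_add,
      map_sum] at e
    simp only [Derivation.leibniz, smul_eq_mul, Finset.sum_add_distrib, coeff_field, hκ1] at e
    simp only [add_mul, Finset.sum_add_distrib]
    rw [Finset.sum_range_succ' (fun j => (if j = 0 then 0 else
      (Ring.choose (k + (j - 1 : ℕ)) j • κ (k + (j - 1 : ℕ))) • 1) * (ddx 𝕜)^[j] f)]
    simp only [if_pos, zero_mul, add_zero, Nat.succ_ne_zero, if_false, Nat.add_sub_cancel]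
    have e1 : ∑ j ∈ Finset.range (M + 1), a j * (ddx 𝕜)^[j] (ddx 𝕜 f) =
        ∑ j ∈ Finset.range (M + 1), a j * ddx 𝕜 ((ddx 𝕜)^[j] f) :=
      Finset.sum_congr rfl fun j _ => by
        rw [← Function.iterate_succ_apply, Function.iterate_succ_apply']
    have e2 : ∑ n ∈ Finset.range M, Ring.choose (k + n) (n + 1) •
        ((ddx 𝕜)^[n + 1] f * κ (k + n) • 1) = ∑ n ∈ Finset.range M,
        (Ring.choose (k + n) (n + 1) • κ (k + n)) • 1 * (ddx 𝕜)^[n + 1] f :=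
      Finset.sum_congr rfl fun n _ => by
        rw [mul_smul_comm, mul_one, smul_mul_assoc, one_mul, smul_assoc]
    have e3 : ∑ j ∈ Finset.range (M + 1), (ddx 𝕜)^[j] f * ddx 𝕜 (a j) =
        ∑ j ∈ Finset.range (M + 1), ddx 𝕜 (a j) * (ddx 𝕜)^[j] f :=
      Finset.sum_congr rfl fun n _ => mul_comm _ _
    rw [e1, e2, e3, add_assoc] at e
    exact left_eq_add.1 e
  have hcoef : ∀ j < M + 1, ∃ r : 𝕜, ddx 𝕜 (a j) = r • 1 ∧ (j = 1 → r = -(k * κ k)) := by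
    intro j hj
    have := eq_zero_of_sum_mul_ddx_iterate_eq_zero key hj
    rcases Nat.eq_zero_or_pos j with rfl | hj0
    · rw [if_pos rfl, add_zero] at this
      exact ⟨0, by rw [this, zero_smul], fun h => absurd h zero_ne_one⟩
    · rw [if_neg hj0.ne'] at this
      refine ⟨-(Ring.choose (k + (j - 1 : ℕ)) j • κ (k + (j - 1 : ℕ))), ?_, ?_⟩
      · rw [neg_smul]
        exact eq_neg_of_add_eq_zero_left this
      · rintro rfl
        simp
  have hconst : ∀ j < M + 1, a j = ev 0 (a j) • 1 := by
    intro j hj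
    obtain ⟨r, hr, -⟩ := hcoef j hj
    rw [const_eq_zero_of_ddx_eq hr, zero_smul] at hr
    exact eq_const_of_ddx_eq_zero hr
  refine ⟨fun j => if j < M + 1 then ev 0 (a j) else 0, M + 1, fun j hj => if_neg (not_lt.2 hj),
    fun hk => ?_, fun f => ?_⟩
  · obtain ⟨r, hr, hr1⟩ := hcoef 1 (by omega)
    rw [hr1 rfl] at hr
    have h0 := const_eq_zero_of_ddx_eq hr
    have h2 : κ k = 0 := by
      rw [neg_eq_zero] at h0
      exact (mul_eq_zero.1 h0).resolve_left (by exact_mod_cast hk)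
    dsimp only
    rw [if_pos (Nat.succ_pos _)]
    have h3 := congrArg (ev 0) (ha 1)
    rw [Finset.sum_range_succ', Finset.sum_eq_zero fun n _ => by
      rw [ddx_iterate_succ_one, mul_zero]] at h3
    simp only [Function.iterate_zero, id, mul_one, zero_add] at h3
    rw [← h3]
    exact h2
  · rw [ha]
    refine Finset.sum_congr rfl fun j hj => ?_
    have hj' := Finset.mem_range.1 hj
    dsimp only
    rw [if_pos hj']
    conv_lhs => rw [hconst j hj']
    rw [smul_mul_assoc, one_mul]

/-! ### Homogeneous cocycles with constant coefficients -/

/-- The sequences `a` with `a 0 = 0` for which `f ∂ ↦ ∑ a_n f^(n) ξ^(1-n)` is a cocycle: the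
equation with index `(i, j)` is the vanishing of the coefficient of `f^(i+1) g^(j+1) ξ^(-i-j)` in
the cocycle condition for `f ∂` and `g ∂`. -/
def cocycleSeq (𝕜 : Type*) [RCLike 𝕜] : Submodule 𝕜 (ℕ → 𝕜) where
  carrier := {a | a 0 = 0 ∧ ∀ i j : ℕ,
    a (i + j + 1) * ((i + j + 1).choose (i + 1) - (i + j + 1).choose i : 𝕜) =
      (Ring.choose (-(i : ℤ)) (j + 1) : ℤ) * a (i + 1) -
        (Ring.choose (-(j : ℤ)) (i + 1) : ℤ) * a (j + 1)}
  add_mem' := fun {a b} ha hb => ⟨by rw [Pi.add_apply, ha.1, hb.1, add_zero], fun i j => by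
    simp only [Pi.add_apply]
    linear_combination ha.2 i j + hb.2 i j⟩
  zero_mem' := ⟨rfl, fun i j => by simp⟩
  smul_mem' := fun c a ha => ⟨by rw [Pi.smul_apply, ha.1, smul_zero], fun i j => by
    simp only [Pi.smul_apply, smul_eq_mul]
    linear_combination c * ha.2 i j⟩

theorem choose_neg_succ (i j : ℕ) : ((Ring.choose (-(j : ℤ)) (i + 1) : ℤ) : 𝕜) =
    (-1) ^ (i + 1) * ((i + j).choose (i + 1) : 𝕜) := by
  rw [Ring.choose_neg, show (j : ℤ) + ((i + 1 : ℕ) : ℤ) - 1 = ((i + j : ℕ) : ℤ) by push_cast; ring,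
    Ring.choose_natCast, Int.negOnePow_def]
  rw [zpow_natCast, Units.smul_def]
  push_cast
  simp

/-- The sequence `(-1)^(n-1) (x + y / n)` for `n ≥ 1`, with the entry `z` added at `n = 1` and the
entry `0` at `n = 0`. The sequences of coefficients of `θ₁`, `θ₂`, `θ₃` are of this form. -/
def rationalSeq (x y z : 𝕜) (n : ℕ) : 𝕜 :=
  if n = 0 then 0 else (-1) ^ (n - 1) * (x + y / n + if n = 1 then z else 0)

theorem rationalSeq_mem (x y z : 𝕜) : rationalSeq x y z ∈ cocycleSeq 𝕜 := by
  refine ⟨if_pos rfl, fun i j => ?_⟩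
  have hC : ((i + j + 1).choose (i + 1) : 𝕜) = (i + j).choose i + (i + j).choose (i + 1) := by
    exact_mod_cast Nat.choose_succ_succ' (i + j) i
  have hC' : ((i + j + 1).choose i : 𝕜) = (i + j).choose i + (i + j).choose (j + 1) := by
    have h1 : (i + j + 1).choose i = (i + j + 1).choose (j + 1) :=
      Nat.choose_symm_of_eq_add (by ring)
    have h2 : (i + j).choose i = (i + j).choose j := Nat.choose_symm_of_eq_add rfl
    rw [h1, h2]
    exact_mod_cast Nat.choose_succ_succ' (i + j) j
  have hA : ((i + j).choose (i + 1) : 𝕜) * (i + 1) = (i + j).choose i * j := by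
    have := Nat.choose_succ_right_eq (i + j) i
    rw [Nat.add_sub_cancel_left] at this
    exact_mod_cast this
  have hB : ((i + j).choose (j + 1) : 𝕜) * (j + 1) = (i + j).choose i * i := by
    have := Nat.choose_succ_right_eq (i + j) j
    rw [Nat.add_sub_cancel, ← Nat.choose_symm_of_eq_add (a := i) rfl] at this
    exact_mod_cast this
  rw [choose_neg_succ, choose_neg_succ, add_comm j i, hC, hC']
  simp only [rationalSeq, Nat.succ_ne_zero, if_false, Nat.add_sub_cancel]
  have hi : (i + 1 : 𝕜) ≠ 0 := by exact_mod_cast i.succ_ne_zero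
  have hj : (j + 1 : 𝕜) ≠ 0 := by exact_mod_cast j.succ_ne_zero
  have hij : (i + j + 1 : 𝕜) ≠ 0 := by exact_mod_cast (i + j).succ_ne_zero
  have hA' := eq_div_of_mul_eq hi hA
  have hB' := eq_div_of_mul_eq hj hB
  have hz : (if i + j + 1 = 1 then z else 0) *
      (((i + j).choose (i + 1) : 𝕜) - (i + j).choose (j + 1)) =
      ((i + j).choose (i + 1) : 𝕜) * (if j + 1 = 1 then z else 0) -
      ((i + j).choose (j + 1) : 𝕜) * (if i + 1 = 1 then z else 0) := by
    rcases Nat.eq_zero_or_pos i with rfl | h1 <;> rcases Nat.eq_zero_or_pos j with rfl | h2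
    · simp
    · have h3 : j ≠ 0 := h2.ne'
      simp [h3]
    · have h3 : i ≠ 0 := h1.ne'
      simp [h3]
    · have h3 : j ≠ 0 := h2.ne'
      have h4 : i ≠ 0 := h1.ne'
      simp [h3, h4]
  have hy : y / (i + j + 1) * (((i + j).choose (i + 1) : 𝕜) - (i + j).choose (j + 1)) =
      ((i + j).choose (i + 1) : 𝕜) * (y / (j + 1)) -
      ((i + j).choose (j + 1) : 𝕜) * (y / (i + 1)) := by
    rw [hA', hB']
    field_simp
    ring
  simp only [Nat.add_eq_right, Nat.add_eq_zero_iff] at hz ⊢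
  push_cast
  linear_combination (-1) ^ (i + j) * (hz + hy)

/-- An element of `cocycleSeq` is determined by its entries with index `1`, `2`, `3`: the equations
with `i = 1` express the entry with index `n` through the entries with index `2` and `n - 1`, with
the coefficient `n (n - 3) / 2`. -/
theorem cocycleSeq_eq_zero {a : ℕ → 𝕜} (ha : a ∈ cocycleSeq 𝕜) (h1 : a 1 = 0) (h2 : a 2 = 0)
    (h3 : a 3 = 0) : a = 0 := by
  have h4 : ∀ n, a (n + 3) = 0 := by
    intro n
    induction n with
    | zero => exact h3
    | succ n ih =>
      have h := ha.2 1 (n + 2)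
      rw [show n + 2 + 1 = n + 3 from rfl, ih, h2, mul_zero, mul_zero, sub_zero,
        show 1 + (n + 2) + 1 = n + 1 + 3 by ring] at h
      refine (mul_eq_zero.1 h).resolve_right (sub_ne_zero.2 ?_)
      rw [Nat.choose_one_right]
      intro hc
      have hc' : (n + 1 + 3).choose 2 = n + 1 + 3 := by exact_mod_cast hc
      rw [Nat.choose_two_right] at hc'
      have h5 : (n + 1 + 3) * (n + 1 + 3 - 1) = (n + 4) * (n + 1) + 2 * (n + 4) := by
        rw [show n + 1 + 3 - 1 = n + 3 by omega]; ring
      have h6 : 0 < (n + 4) * (n + 1) := by positivity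
      have h7 : 4 ≤ (n + 4) * (n + 1) := by nlinarith
      omega
  funext n
  rcases n with _ | _ | _ | n
  · exact ha.1
  · exact h1
  · exact h2
  · exact h4 n

theorem coeff_seriesCochain_of_one_le {a : ℕ → 𝕜} (ha : a 0 = 0) (X : VectS1 𝕜) {k : ℤ}
    (hk : 1 ≤ k) : (seriesCochain a X).coeff k = 0 := by
  rcases hk.eq_or_lt with rfl | hk
  · have := coeff_seriesCochain a X 0
    rw [Nat.cast_zero, sub_zero, ha, zero_smul] at this
    exact this
  · exact if_neg (not_le.2 hk)

theorem coeff_seriesCochain_neg (a : ℕ → 𝕜) (X : VectS1 𝕜) (s : ℕ) :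
    (seriesCochain a X).coeff (-s) = a (s + 1) • (ddx 𝕜)^[s + 1] (VectS1.coeff 𝕜 X) := by
  rw [← coeff_seriesCochain]
  congr 1
  push_cast
  ring

theorem seriesCochain_mem_orderLE {a : ℕ → 𝕜} (ha : a 0 = 0) (X : VectS1 𝕜) :
    seriesCochain a X ∈ orderLE 𝕜 0 := fun _ hk => coeff_seriesCochain_of_one_le ha X hk

theorem coeff_lie_seriesCochain {a : ℕ → 𝕜} (ha : a 0 = 0) (f g : smoothCircle 𝕜) (s : ℕ) :
    (⁅field f, seriesCochain a (field g)⁆ : PsiD 𝕜).coeff (-s) =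
      a (s + 1) • (f * (ddx 𝕜)^[s + 2] g) - ∑ p ∈ Finset.HasAntidiagonal.antidiagonal s,
        (((Ring.choose (-(p.2 : ℤ)) (p.1 + 1) : ℤ) : 𝕜) * a (p.2 + 1)) •
          ((ddx 𝕜)^[p.1 + 1] f * (ddx 𝕜)^[p.2 + 1] g) := by
  rw [coeff_lie_symbol _ _ _ (s + 1) (fun j hj =>
    coeff_seriesCochain_of_one_le ha _ (by push_cast at hj; omega)), coeff_seriesCochain_neg,
    coeff_field, coeff_field, Derivation.map_smul, mul_smul_comm,
    Finset.Nat.sum_antidiagonal_eq_sum_range_succ_mk]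
  congr 1
  · rw [← Function.iterate_succ_apply' (ddx 𝕜)]
  · refine Finset.sum_congr rfl fun n hn => ?_
    have hn' := Finset.mem_range.1 hn
    rw [show (-s + n : ℤ) = -((s - n : ℕ) : ℤ) by omega, coeff_seriesCochain_neg, coeff_field,
      mul_smul_comm, mul_smul, Int.cast_smul_eq_zsmul]

/-- The Leibniz rule for a bracket, with the terms that contain `f` or `g` undifferentiated split
off. -/
theorem ddx_iterate_bracket (f g : smoothCircle 𝕜) (s : ℕ) :
    (ddx 𝕜)^[s + 1] (f * ddx 𝕜 g - ddx 𝕜 f * g) =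
      f * (ddx 𝕜)^[s + 2] g - (ddx 𝕜)^[s + 2] f * g +
      ∑ p ∈ Finset.HasAntidiagonal.antidiagonal s,
        (((s + 1).choose (p.1 + 1) : 𝕜) - ((s + 1).choose p.1 : 𝕜)) •
          ((ddx 𝕜)^[p.1 + 1] f * (ddx 𝕜)^[p.2 + 1] g) := by
  have h : ∀ u v : smoothCircle 𝕜, (ddx 𝕜)^[s + 1] (u - v) =
      (ddx 𝕜)^[s + 1] u - (ddx 𝕜)^[s + 1] v := fun u v => by
    rw [sub_eq_add_neg, ddx_iterate_add, ← neg_one_smul 𝕜, ddx_iterate_smul, neg_one_smul,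
      ← sub_eq_add_neg]
  rw [h, ddx_iterate_mul, ddx_iterate_mul, Finset.Nat.sum_antidiagonal_succ,
    Finset.Nat.sum_antidiagonal_succ']
  simp only [sub_smul, Finset.sum_sub_distrib, ← Function.iterate_succ_apply, Nat.choose_zero_right,
    Nat.choose_self, one_smul, Function.iterate_zero, id, Nat.cast_smul_eq_nsmul,
    Nat.succ_eq_add_one, add_assoc, Nat.reduceAdd]
  abel

theorem seriesCochain_mem_oneCocycles {a : ℕ → 𝕜} (ha : a ∈ cocycleSeq 𝕜) :
    seriesCochain a ∈ oneCocycles 𝕜 (VectS1 𝕜) (PsiD 𝕜) := by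
  rw [mem_oneCocycles_iff]
  suffices key : ∀ f g, seriesCochain a ⁅field f, field g⁆ =
      ⁅field f, seriesCochain a (field g)⁆ - ⁅field g, seriesCochain a (field f)⁆ from
    fun X Y => key (VectS1.coeff 𝕜 X) (VectS1.coeff 𝕜 Y)
  intro f g
  refine PsiD.ext fun k => ?_
  rcases lt_or_ge 0 k with hk | hk
  · rw [PsiD.coeff_sub, seriesCochain_mem_orderLE ha.1 _ k hk,
      lie_mem_orderLE _ (seriesCochain_mem_orderLE ha.1 _) k hk,
      lie_mem_orderLE _ (seriesCochain_mem_orderLE ha.1 _) k hk, sub_zero]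
  · obtain ⟨s, rfl⟩ : ∃ s : ℕ, k = -s := ⟨k.natAbs, by omega⟩
    rw [PsiD.coeff_sub, coeff_lie_seriesCochain ha.1, coeff_lie_seriesCochain ha.1, lie_field,
      coeff_seriesCochain_neg, coeff_field, ddx_iterate_bracket,
      ← Finset.Nat.sum_antidiagonal_swap (f := fun p : ℕ × ℕ =>
        (((Ring.choose (-(p.2 : ℤ)) (p.1 + 1) : ℤ) : 𝕜) * a (p.2 + 1)) •
          ((ddx 𝕜)^[p.1 + 1] g * (ddx 𝕜)^[p.2 + 1] f))]
    have e : a (s + 1) • ∑ p ∈ Finset.HasAntidiagonal.antidiagonal s,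
        (((s + 1).choose (p.1 + 1) : 𝕜) - ((s + 1).choose p.1 : 𝕜)) •
          ((ddx 𝕜)^[p.1 + 1] f * (ddx 𝕜)^[p.2 + 1] g) =
        ∑ p ∈ Finset.HasAntidiagonal.antidiagonal s,
          (((Ring.choose (-(p.1 : ℤ)) (p.2 + 1) : ℤ) : 𝕜) * a (p.1 + 1)) •
            ((ddx 𝕜)^[p.2 + 1] g * (ddx 𝕜)^[p.1 + 1] f) -
        ∑ p ∈ Finset.HasAntidiagonal.antidiagonal s,
          (((Ring.choose (-(p.2 : ℤ)) (p.1 + 1) : ℤ) : 𝕜) * a (p.2 + 1)) •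
            ((ddx 𝕜)^[p.1 + 1] f * (ddx 𝕜)^[p.2 + 1] g) := by
      rw [Finset.smul_sum, ← Finset.sum_sub_distrib]
      refine Finset.sum_congr rfl fun p hp => ?_
      rw [Finset.HasAntidiagonal.mem_antidiagonal] at hp
      have := ha.2 p.1 p.2
      rw [hp] at this
      rw [mul_comm ((ddx 𝕜)^[p.2 + 1] g), ← sub_smul, ← this, smul_smul]
    rw [smul_add, e, smul_sub, mul_comm g]
    simp only [Prod.fst_swap, Prod.snd_swap]
    abel

/-- The sequence of coefficients of `θ₁`, `θ₂`, `θ₃`. -/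
def thetaSeq (𝕜 : Type*) [RCLike 𝕜] : Fin 3 → ℕ → 𝕜 :=
  ![rationalSeq 0 0 1, rationalSeq 2 (-6) 4, rationalSeq 3 (-6) 3]

theorem thetaSeq_mem (i : Fin 3) : thetaSeq 𝕜 i ∈ cocycleSeq 𝕜 := by
  fin_cases i <;> exact rationalSeq_mem _ _ _

/-- The entries of `thetaSeq` with index `1`, `2`, `3` form the identity matrix. -/
theorem thetaSeq_apply (i j : Fin 3) : thetaSeq 𝕜 i (j.val + 1) = if i = j then (1 : 𝕜) else 0 := by
  fin_cases i <;> fin_cases j <;> simp [thetaSeq, rationalSeq] <;> norm_num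

theorem theta_succ (i : Fin 3) : theta 𝕜 i.succ = seriesCochain (thetaSeq 𝕜 i) := by
  fin_cases i
  · refine LinearMap.ext fun X => PsiD.ext fun k => ?_
    change (theta1 𝕜 X).coeff k = (seriesCochain (rationalSeq 0 0 1) X).coeff k
    rw [theta1]
    change (PsiD.monomial 0 _).coeff k = _
    rw [PsiD.coeff_monomial]
    rcases lt_or_ge 0 k with hk | hk
    · rw [if_neg hk.ne', coeff_seriesCochain_of_one_le (rationalSeq_mem _ _ _).1 _ hk]
    · obtain ⟨s, rfl⟩ : ∃ s : ℕ, k = -s := ⟨k.natAbs, by omega⟩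
      rw [coeff_seriesCochain_neg]
      rcases Nat.eq_zero_or_pos s with rfl | hs
      · simp [rationalSeq]
      · rw [if_neg (by omega)]
        simp [rationalSeq, hs.ne']
  · change theta2 𝕜 = seriesCochain (rationalSeq 2 (-6) 4)
    rw [theta2]
    congr 1
    funext n
    rcases n with _ | _ | n
    · simp [rationalSeq]
    · simp [rationalSeq]; norm_num
    · have : ((n : 𝕜) + 1 + 1) ≠ 0 := by exact_mod_cast (n + 1).succ_ne_zero
      simp only [rationalSeq]
      rw [if_pos (by omega), if_neg (by omega), if_neg (by omega)]
      push_cast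
      field_simp
      ring
  · change theta3 𝕜 = seriesCochain (rationalSeq 3 (-6) 3)
    rw [theta3]
    congr 1
    funext n
    rcases n with _ | _ | _ | n
    · simp [rationalSeq]
    · simp [rationalSeq]; norm_num
    · simp [rationalSeq]; norm_num
    · have : ((n : 𝕜) + 1 + 1 + 1) ≠ 0 := by exact_mod_cast (n + 2).succ_ne_zero
      simp only [rationalSeq]
      rw [if_pos (by omega), if_neg (by omega), if_neg (by omega)]
      push_cast
      field_simp
      ring

theorem coeff_theta0 (X : VectS1 𝕜) (k : ℤ) :
    (theta0 𝕜 X).coeff k = if k = 0 then VectS1.coeff 𝕜 X else 0 :=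
  PsiD.coeff_monomial _ _ _

theorem coeff_lie_theta0 (X Y : VectS1 𝕜) (k : ℤ) : (⁅X, theta0 𝕜 Y⁆ : PsiD 𝕜).coeff k =
    if k = 0 then VectS1.coeff 𝕜 X * ddx 𝕜 (VectS1.coeff 𝕜 Y) else 0 := by
  rw [coeff_lie_symbol X _ k (1 - k).toNat (fun j hj => by
    rw [coeff_theta0, if_neg (by omega)]), Finset.sum_eq_zero, sub_zero, coeff_theta0]
  · split_ifs <;> simp
  · intro n _
    rw [coeff_theta0]
    split_ifs with h
    · rw [h, Ring.choose_zero_succ, zero_smul]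
    · rw [mul_zero, smul_zero]

theorem theta_mem_oneCocycles (i : Fin 4) : theta 𝕜 i ∈ oneCocycles 𝕜 (VectS1 𝕜) (PsiD 𝕜) := by
  refine Fin.cases ?_ (fun i => ?_) i
  · change theta0 𝕜 ∈ _
    rw [mem_oneCocycles_iff]
    intro X Y
    refine PsiD.ext fun k => ?_
    rw [PsiD.coeff_sub, coeff_lie_theta0, coeff_lie_theta0, coeff_theta0, VectS1.coeff_lie]
    split_ifs
    · rw [mul_comm (VectS1.coeff 𝕜 Y)]
    · rw [sub_zero]
  · rw [theta_succ]
    exact seriesCochain_mem_oneCocycles (thetaSeq_mem i)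

/-! ### Classification of the cocycles -/

theorem jet_bracket {L i j n : ℕ} {f g : smoothCircle 𝕜} (hn : n + 1 < L)
    (hf : ∀ l < L, jet 0 l f = (Pi.single (i + 1) 1 : ℕ → 𝕜) l)
    (hg : ∀ l < L, jet 0 l g = (Pi.single (j + 1) 1 : ℕ → 𝕜) l) :
    jet 0 n (f * ddx 𝕜 g - ddx 𝕜 f * g) =
      if n = i + j + 1 then (n.choose (i + 1) : 𝕜) - n.choose i else 0 := by
  rcases n with _ | s
  · have h1 := hf 0 (by omega)
    have h2 := hg 0 (by omega)
    rw [Pi.single_eq_of_ne (by omega)] at h1 h2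
    rw [if_neg (by omega), jet_zero, map_sub, map_mul, map_mul, ← jet_zero, ← jet_zero 0 g, h1, h2,
      zero_mul, mul_zero, sub_zero]
  · have h1 := hf 0 (by omega)
    have h2 := hg 0 (by omega)
    rw [Pi.single_eq_of_ne (by omega), jet_zero] at h1 h2
    rw [jet_apply, ddx_iterate_bracket, map_add, map_sub, map_mul, map_mul, h1, h2, zero_mul,
      mul_zero, sub_zero, zero_add, map_sum]
    have e : ∀ p ∈ Finset.HasAntidiagonal.antidiagonal s,
        ev 0 ((((s + 1).choose (p.1 + 1) : 𝕜) - ((s + 1).choose p.1 : 𝕜)) •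
          ((ddx 𝕜)^[p.1 + 1] f * (ddx 𝕜)^[p.2 + 1] g)) =
        if p = (i, j) then ((s + 1).choose (i + 1) : 𝕜) - (s + 1).choose i else 0 := by
      intro p hp
      rw [Finset.HasAntidiagonal.mem_antidiagonal] at hp
      rw [map_smul, map_mul, ← jet_apply, ← jet_apply, hf _ (by omega), hg _ (by omega),
        Pi.single_apply, Pi.single_apply, smul_eq_mul]
      obtain ⟨p1, p2⟩ := p
      simp only [Prod.mk.injEq, Nat.add_right_cancel_iff]
      by_cases h3 : p1 = i <;> by_cases h4 : p2 = j <;> simp [h3, h4]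
    rw [Finset.sum_congr rfl e, Finset.sum_ite_eq']
    simp only [Finset.HasAntidiagonal.mem_antidiagonal, Nat.add_right_cancel_iff, eq_comm (a := s)]

/-- The cocycle condition for constant coefficients, at vector fields with prescribed jets. -/
theorem constant_coefficients_relation {c : oneCochain 𝕜 (VectS1 𝕜) (PsiD 𝕜)}
    (hc : c ∈ oneCocycles 𝕜 (VectS1 𝕜) (PsiD 𝕜)) {N : ℤ} (hN : ∀ X, c X ∈ orderLE 𝕜 N)
    {a : ℤ → ℕ → 𝕜} {m : ℤ → ℕ} (h0 : ∀ k j, m k ≤ j → a k j = 0)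
    (ha : ∀ k f, (c (field f)).coeff k = ∑ j ∈ Finset.range (m k), a k j • (ddx 𝕜)^[j] f)
    (k : ℤ) (i j : ℕ) :
    a k (i + j + 1) * ((i + j + 1).choose (i + 1) - (i + j + 1).choose i : 𝕜) =
      (Ring.choose (k + j) (j + 1) : ℤ) * a (k + j) (i + 1) -
        (Ring.choose (k + i) (i + 1) : ℤ) * a (k + i) (j + 1) := by
  rw [mem_oneCocycles_iff] at hc
  obtain ⟨M, hM⟩ : ∃ M, M = (N + 1 - k).toNat + i + j + 1 := ⟨_, rfl⟩
  obtain ⟨L, hL⟩ : ∃ L, L = m k + m (k + i) + m (k + j) + M + 2 := ⟨_, rfl⟩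
  obtain ⟨f, hf⟩ := exists_jet_eq_at 0 L (Pi.single (i + 1) (1 : 𝕜))
  obtain ⟨g, hg⟩ := exists_jet_eq_at 0 L (Pi.single (j + 1) (1 : 𝕜))
  have hcoef : ∀ l i' (u : smoothCircle 𝕜), m l ≤ L →
      (∀ n < L, jet 0 n u = (Pi.single i' 1 : ℕ → 𝕜) n) →
      ev 0 ((c (field u)).coeff l) = a l i' := by
    intro l i' u hl hu
    rw [ha, map_sum, Finset.sum_congr rfl fun n hn => by
      rw [map_smul, ← jet_apply, hu n ((Finset.mem_range.1 hn).trans_le hl), Pi.single_apply,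
        smul_ite, smul_eq_mul, mul_one, smul_zero], Finset.sum_ite_eq']
    split_ifs with h
    · rfl
    · rw [h0 l i' (by rwa [Finset.mem_range, not_lt] at h)]
  have hlie : ∀ i' j' (u v : smoothCircle 𝕜), i' < M → m (k + i') ≤ L →
      (∀ n < L, jet 0 n u = (Pi.single (i' + 1) 1 : ℕ → 𝕜) n) →
      (∀ n < L, jet 0 n v = (Pi.single (j' + 1) 1 : ℕ → 𝕜) n) →
      ev 0 ((⁅field u, c (field v)⁆ : PsiD 𝕜).coeff k) =
        -((Ring.choose (k + i') (i' + 1) : ℤ) * a (k + i') (j' + 1)) := by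
    intro i' j' u v hi' hL' hu hv
    have hu0 := hu 0 (by omega)
    rw [Pi.single_eq_of_ne (by omega), jet_zero] at hu0
    rw [coeff_lie_symbol _ _ k M (fun l hl => hN _ l (by omega)), map_sub, map_mul, coeff_field,
      hu0, zero_mul, zero_sub, map_sum, Finset.sum_eq_single i']
    · rw [map_zsmul, map_mul, ← jet_apply, hu _ (by omega), Pi.single_eq_same, one_mul,
        hcoef _ _ v hL' hv, zsmul_eq_mul]
    · intro n hn hne
      rw [map_zsmul, map_mul, ← jet_apply, hu _ (by have := Finset.mem_range.1 hn; omega),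
        Pi.single_eq_of_ne (by omega), zero_mul, smul_zero]
    · intro h
      exact absurd (Finset.mem_range.2 hi') h
  have e := congrArg (fun F => ev 0 (F.coeff k)) (hc (field f) (field g))
  rw [PsiD.coeff_sub, map_sub, hlie i j f g (by omega) (by omega) hf hg,
    hlie j i g f (by omega) (by omega) hg hf, lie_field, ha, map_sum] at e
  rw [Finset.sum_congr rfl fun n hn => by
    rw [map_smul, ← jet_apply, jet_bracket (by have := Finset.mem_range.1 hn; omega) hf hg,
      smul_ite, smul_zero], Finset.sum_ite_eq'] at e
  have e2 : a k (i + j + 1) * ((i + j + 1).choose (i + 1) - (i + j + 1).choose i : 𝕜) =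
      if i + j + 1 ∈ Finset.range (m k) then
        a k (i + j + 1) • ((i + j + 1).choose (i + 1) - (i + j + 1).choose i : 𝕜) else 0 := by
    split_ifs with h
    · rfl
    · rw [h0 k _ (by rwa [Finset.mem_range, not_lt] at h), zero_mul]
  rw [e2, e]
  ring

/-- Every cocycle is cohomologous to one whose value at `∂` has constant coefficients. -/
theorem exists_ddx_coeff_sub_eq_zero (c : oneCochain 𝕜 (VectS1 𝕜) (PsiD 𝕜)) :
    ∃ F : PsiD 𝕜, ∀ k, ddx 𝕜 (((c - d₀₁ 𝕜 (VectS1 𝕜) (PsiD 𝕜) F) (field 1)).coeff k) = 0 := by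
  obtain ⟨N, hN⟩ := exists_mem_orderLE (c (field 1))
  have h : ∀ k, ∃ g : smoothCircle 𝕜, (N < k → g = 0) ∧
      ∃ r : 𝕜, (c (field 1)).coeff k = r • 1 + ddx 𝕜 g := by
    intro k
    rcases lt_or_ge N k with hk | hk
    · exact ⟨0, fun _ => rfl, 0, by rw [hN k hk, zero_smul, map_zero, add_zero]⟩
    · obtain ⟨r, g, hg⟩ := exists_eq_const_add_ddx ((c (field 1)).coeff k)
      exact ⟨g, fun h => absurd h (not_lt.2 hk), r, hg⟩
  choose g hg0 r hg using h
  refine ⟨PsiD.mk g ⟨N, hg0⟩, fun k => ?_⟩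
  rw [LinearMap.sub_apply, d₀₁_apply, PsiD.coeff_sub, coeff_field_one_lie, PsiD.coeff_mk, hg,
    add_sub_cancel_right, ddx_const]

/-- A cocycle with constant coefficients is a multiple of `θ₀`, plus a homogeneous cocycle of
degree zero, plus the coboundary of a symbol with constant coefficients. -/
theorem exists_eq_of_constant_coefficients {c : oneCochain 𝕜 (VectS1 𝕜) (PsiD 𝕜)}
    (hc : c ∈ oneCocycles 𝕜 (VectS1 𝕜) (PsiD 𝕜)) {N : ℤ} (hN : ∀ X, c X ∈ orderLE 𝕜 N)
    {a : ℤ → ℕ → 𝕜} {m : ℤ → ℕ} (h0 : ∀ k j, m k ≤ j → a k j = 0) (h00 : ∀ k, k ≠ 0 → a k 0 = 0)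
    (ha : ∀ k f, (c (field f)).coeff k = ∑ j ∈ Finset.range (m k), a k j • (ddx 𝕜)^[j] f) :
    ∃ F : PsiD 𝕜, ∃ b ∈ cocycleSeq 𝕜, ∃ x : 𝕜,
      c = d₀₁ 𝕜 (VectS1 𝕜) (PsiD 𝕜) F + (x • theta0 𝕜 + seriesCochain b) := by
  have rel := constant_coefficients_relation hc hN h0 ha
  -- the relation for `i = 0` determines the part of nonzero degree
  have rel0 : ∀ (k : ℤ) (j : ℕ), ((k + j : ℤ) : 𝕜) * a k (j + 1) =
      (Ring.choose (k + j) (j + 1) : ℤ) * a (k + j) 1 := by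
    intro k j
    have h := rel k 0 j
    simp only [zero_add, Nat.choose_one_right, Nat.choose_zero_right, Nat.cast_zero, add_zero,
      Ring.choose_one_right] at h
    push_cast at h ⊢
    linear_combination h
  have hzero : ∀ k, N < k → a k 1 = 0 := by
    intro k hk
    obtain ⟨f, hf⟩ := exists_jet_eq_at 0 (m k + 2) (Pi.single 1 (1 : 𝕜))
    have h1 := congrArg (ev 0) (ha k f)
    rw [hN _ k hk, map_zero, map_sum, Finset.sum_congr rfl fun n hn => by
      rw [map_smul, ← jet_apply, hf n (by have := Finset.mem_range.1 hn; omega), Pi.single_apply,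
        smul_ite, smul_eq_mul, mul_one, smul_zero], Finset.sum_ite_eq'] at h1
    split_ifs at h1 with h
    · exact h1.symm
    · exact h0 k 1 (by rwa [Finset.mem_range, not_lt] at h)
  set F : PsiD 𝕜 := PsiD.mk (fun w => (if w = 0 then 0 else -(a w 1 / w)) • 1)
    ⟨N, fun k hk => by rw [hzero k hk, zero_div, neg_zero, ite_self, zero_smul]⟩ with hF
  have hFc : ∀ w, F.coeff w = (if w = 0 then 0 else -(a w 1 / w)) • 1 := fun _ => rfl
  have hFN : F ∈ orderLE 𝕜 N := fun k hk => by
    rw [hFc, hzero k hk, zero_div, neg_zero, ite_self, zero_smul]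
  set b : ℕ → 𝕜 := fun n => if n = 0 then 0 else a (1 - n) n with hb
  have hbs : ∀ s : ℕ, b (s + 1) = a (-s) (s + 1) := fun s => by
    simp only [hb, if_neg s.succ_ne_zero]
    congr 1
    push_cast
    ring
  have hbmem : b ∈ cocycleSeq 𝕜 := by
    refine ⟨if_pos rfl, fun i j => ?_⟩
    have h := rel (-(i + j : ℕ)) i j
    rw [show (-(i + j : ℕ) + j : ℤ) = -i by push_cast; ring,
      show (-(i + j : ℕ) + i : ℤ) = -j by push_cast; ring] at h
    rw [hbs, hbs, hbs]
    exact h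
  refine ⟨F, b, hbmem, a 0 0, ?_⟩
  suffices key : ∀ f, c (field f) = ⁅field f, F⁆ + (a 0 0 • theta0 𝕜 (field f) +
      seriesCochain b (field f)) from LinearMap.ext fun X => key (VectS1.coeff 𝕜 X)
  intro f
  refine PsiD.ext fun k => ?_
  obtain ⟨M, hM⟩ : ∃ M, M = m k + (N + 1 - k).toNat + (-k).toNat + 1 := ⟨_, rfl⟩
  have hsum : (c (field f)).coeff k =
      ∑ n ∈ Finset.range M, a k (n + 1) • (ddx 𝕜)^[n + 1] f + a k 0 • f := by
    rw [ha, Finset.sum_subset (Finset.range_mono (show m k ≤ M + 1 by omega)) fun n _ hn => by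
      rw [h0 k n (by simpa using hn), zero_smul], Finset.sum_range_succ']
    rfl
  have hterm : ∀ n ∈ Finset.range M, a k (n + 1) • (ddx 𝕜)^[n + 1] f =
      (if k + n = 0 then a k (n + 1) • (ddx 𝕜)^[n + 1] f else 0) -
        Ring.choose (k + n) (n + 1) • ((ddx 𝕜)^[n + 1] f * F.coeff (k + n)) := by
    intro n _
    rw [hFc]
    split_ifs with h
    · rw [zero_smul, mul_zero, smul_zero, sub_zero]
    · rw [mul_smul_comm, mul_one, ← Int.cast_smul_eq_zsmul 𝕜, smul_smul, zero_sub, ← neg_smul]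
      congr 1
      have h1 : ((k + n : ℤ) : 𝕜) ≠ 0 := by exact_mod_cast h
      rw [mul_neg, neg_neg, ← mul_div_assoc, ← rel0, mul_div_cancel_left₀ _ h1]
  rw [hsum, PsiD.coeff_add, PsiD.coeff_add, PsiD.coeff_smul, coeff_theta0,
    coeff_lie_symbol _ _ k M (fun j hj => hFN j (by omega)), Finset.sum_congr rfl hterm,
    Finset.sum_sub_distrib, hFc, ddx_const, mul_zero, zero_sub, coeff_field]
  have h1 : ∑ n ∈ Finset.range M, (if k + n = 0 then a k (n + 1) • (ddx 𝕜)^[n + 1] f else 0) =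
      (seriesCochain b (field f)).coeff k := by
    rcases lt_or_ge 0 k with hk | hk
    · rw [coeff_seriesCochain_of_one_le hbmem.1 _ hk]
      exact Finset.sum_eq_zero fun n _ => if_neg (by omega)
    · obtain ⟨s, rfl⟩ : ∃ s : ℕ, k = -s := ⟨k.natAbs, by omega⟩
      rw [coeff_seriesCochain_neg, hbs, Finset.sum_eq_single s]
      · rw [if_pos (by omega), coeff_field]
      · intro n _ hn
        exact if_neg (by omega)
      · intro h
        exact absurd (Finset.mem_range.2 (by omega)) h
  have h2 : a k 0 • f = a 0 0 • (if k = 0 then f else 0) := by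
    split_ifs with h
    · rw [h]
    · rw [h00 k h, zero_smul, smul_zero]
  rw [h1, h2]
  abel

theorem seriesCochain_sum (x : Fin 3 → 𝕜) (b : Fin 3 → ℕ → 𝕜) :
    seriesCochain (∑ i, x i • b i) = ∑ i, x i • seriesCochain (b i) := by
  refine LinearMap.ext fun X => PsiD.ext fun k => ?_
  simp only [Fin.sum_univ_three, LinearMap.add_apply, LinearMap.smul_apply, PsiD.coeff_add,
    PsiD.coeff_smul, seriesCochain, LinearMap.coe_mk, AddHom.coe_mk, PsiD.coeff_mk, Pi.add_apply,
    Pi.smul_apply, smul_eq_mul]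
  split_ifs
  · simp only [add_smul, mul_smul]
  · simp only [smul_zero, add_zero]

theorem sum_smul_thetaSeq_mem (x : Fin 3 → 𝕜) : ∑ i, x i • thetaSeq 𝕜 i ∈ cocycleSeq 𝕜 :=
  sum_mem fun i _ => Submodule.smul_mem _ _ (thetaSeq_mem i)

theorem sum_smul_thetaSeq_apply (x : Fin 3 → 𝕜) (j : Fin 3) :
    (∑ i, x i • thetaSeq 𝕜 i) (j.val + 1) = x j := by
  simp [Finset.sum_apply, thetaSeq_apply]

theorem eq_sum_smul_thetaSeq {b : ℕ → 𝕜} (hb : b ∈ cocycleSeq 𝕜) :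
    b = ∑ i : Fin 3, b (i.val + 1) • thetaSeq 𝕜 i := by
  have h : ∀ j : Fin 3, (b - ∑ i : Fin 3, b (i.val + 1) • thetaSeq 𝕜 i) (j.val + 1) = 0 :=
    fun j => by
      rw [Pi.sub_apply, sum_smul_thetaSeq_apply (fun i : Fin 3 => b (i.val + 1)), sub_self]
  exact sub_eq_zero.1 (cocycleSeq_eq_zero (sub_mem hb (sum_smul_thetaSeq_mem _)) (h 0) (h 1) (h 2))

theorem sum_smul_theta (x : Fin 4 → 𝕜) : ∑ i, x i • theta 𝕜 i =
    x 0 • theta0 𝕜 + seriesCochain (∑ i : Fin 3, x i.succ • thetaSeq 𝕜 i) := by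
  rw [Fin.sum_univ_succ, seriesCochain_sum]
  simp only [theta_succ]
  rfl

/-- Every cocycle is cohomologous to a linear combination of `θ₀`, `θ₁`, `θ₂`, `θ₃`. -/
theorem exists_eq_coboundary_add_theta {c : oneCochain 𝕜 (VectS1 𝕜) (PsiD 𝕜)}
    (hc : c ∈ oneCocycles 𝕜 (VectS1 𝕜) (PsiD 𝕜)) : ∃ (F : PsiD 𝕜) (x : Fin 4 → 𝕜),
      c = d₀₁ 𝕜 (VectS1 𝕜) (PsiD 𝕜) F + ∑ i, x i • theta 𝕜 i := by
  obtain ⟨F, hF⟩ := exists_ddx_coeff_sub_eq_zero c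
  have hc' := sub_mem hc (oneCoboundaries_le ⟨F, rfl⟩)
  obtain ⟨N, hN⟩ := exists_forall_mem_orderLE hc'
  choose a m h0 h00 ha using exists_constant_coefficients hc' hN hF
  obtain ⟨G, b, hb, x, h⟩ := exists_eq_of_constant_coefficients hc' hN h0 h00 ha
  refine ⟨F + G, Fin.cons x fun i => b (i.val + 1), ?_⟩
  rw [sum_smul_theta]
  simp only [Fin.cons_zero, Fin.cons_succ]
  rw [← eq_sum_smul_thetaSeq hb, map_add, add_assoc, ← h, add_sub_cancel]

/-- The classes of `θ₀`, `θ₁`, `θ₂`, `θ₃` are linearly independent. -/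
theorem eq_zero_of_sum_smul_theta_eq {x : Fin 4 → 𝕜} {F : PsiD 𝕜}
    (h : ∑ i, x i • theta 𝕜 i = d₀₁ 𝕜 (VectS1 𝕜) (PsiD 𝕜) F) : x = 0 := by
  rw [sum_smul_theta] at h
  have hmem := sum_smul_thetaSeq_mem (fun i : Fin 3 => x i.succ)
  set b := ∑ i : Fin 3, x i.succ • thetaSeq 𝕜 i with hb
  have hk : ∀ (f : smoothCircle 𝕜) k, (⁅field f, F⁆ : PsiD 𝕜).coeff k =
      x 0 • (if k = 0 then f else 0) + (seriesCochain b (field f)).coeff k := by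
    intro f k
    rw [← d₀₁_apply 𝕜, ← h, LinearMap.add_apply, LinearMap.smul_apply, PsiD.coeff_add,
      PsiD.coeff_smul, coeff_theta0, coeff_field]
  have hdF : ∀ k, ddx 𝕜 (F.coeff k) = (if k = 0 then x 0 else 0) • 1 := by
    intro k
    have hs : (seriesCochain b (field 1)).coeff k = 0 := by
      rcases lt_or_ge 0 k with hk | hk
      · exact coeff_seriesCochain_of_one_le hmem.1 _ hk
      · obtain ⟨s, rfl⟩ : ∃ s : ℕ, k = -s := ⟨k.natAbs, by omega⟩
        rw [coeff_seriesCochain_neg, coeff_field, ddx_iterate_succ_one, smul_zero]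
    have h1 := hk 1 k
    rw [coeff_field_one_lie, hs, add_zero] at h1
    rw [h1]
    split_ifs <;> simp
  have hx0 : x 0 = 0 := const_eq_zero_of_ddx_eq (c := x 0) (g := F.coeff 0) (by
    rw [hdF, if_pos rfl])
  have hF : ∀ k, ddx 𝕜 (F.coeff k) = 0 := fun k => by rw [hdF, hx0, ite_self, zero_smul]
  obtain ⟨N, hN⟩ := exists_mem_orderLE F
  have hbs : ∀ s : ℕ, b (s + 1) = 0 := by
    intro s
    obtain ⟨M, hM⟩ : ∃ M, M = (N + 1 + s).toNat + s + 1 := ⟨_, rfl⟩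
    obtain ⟨f, hf⟩ := exists_jet_eq_at 0 (M + 1) (Pi.single (s + 1) (1 : 𝕜))
    have h1 := congrArg (ev 0) (hk f (-s))
    rw [hx0, zero_smul, zero_add, coeff_seriesCochain_neg, map_smul, coeff_field, ← jet_apply,
      hf _ (by omega), Pi.single_eq_same, smul_eq_mul, mul_one,
      coeff_lie_symbol _ _ _ M (fun j hj => hN j (by omega)), hF, mul_zero, zero_sub, map_neg,
      map_sum, Finset.sum_eq_zero, neg_zero] at h1
    · exact h1.symm
    · intro n hn
      rw [map_zsmul, map_mul, coeff_field, ← jet_apply,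
        hf _ (by have := Finset.mem_range.1 hn; omega), Pi.single_apply]
      split_ifs with h2
      · rw [show (-s + n : ℤ) = 0 by omega, Ring.choose_zero_succ, zero_smul]
      · rw [zero_mul, smul_zero]
  funext i
  refine Fin.cases hx0 (fun j => ?_) i
  rw [← sum_smul_thetaSeq_apply (fun i : Fin 3 => x i.succ) j]
  exact hbs _

/-! ### The cohomology and the leading terms -/

theorem sum_smul_classOf (x : Fin 4 → 𝕜) :
    ∑ i, x i • H1.classOf (theta 𝕜 i) (theta_mem_oneCocycles i) =
      H1.classOf (∑ i, x i • theta 𝕜 i)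
        (sum_mem fun i _ => Submodule.smul_mem _ _ (theta_mem_oneCocycles i)) := by
  have h : (⟨∑ i, x i • theta 𝕜 i,
      sum_mem fun i _ => Submodule.smul_mem _ _ (theta_mem_oneCocycles i)⟩ :
      oneCocycles 𝕜 (VectS1 𝕜) (PsiD 𝕜)) =
      ∑ i, x i • (⟨theta 𝕜 i, theta_mem_oneCocycles i⟩ : oneCocycles 𝕜 (VectS1 𝕜) (PsiD 𝕜)) :=
    Subtype.ext (by simp)
  unfold H1.classOf
  rw [h]
  exact (map_sum (Submodule.mkQ _) _ _).symm

theorem linearIndependent_classOf_theta : LinearIndependent 𝕜 fun i : Fin 4 =>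
    H1.classOf (theta 𝕜 i) (theta_mem_oneCocycles i) := by
  rw [Fintype.linearIndependent_iff]
  intro x hx
  rw [sum_smul_classOf] at hx
  obtain ⟨F, hF⟩ := (Submodule.Quotient.mk_eq_zero _).1 hx
  exact congrFun (eq_zero_of_sum_smul_theta_eq hF.symm)

theorem span_classOf_theta : Submodule.span 𝕜 (Set.range fun i : Fin 4 =>
    H1.classOf (theta 𝕜 i) (theta_mem_oneCocycles i)) = ⊤ := by
  refine eq_top_iff.2 fun q _ => ?_
  obtain ⟨⟨c, hc⟩, rfl⟩ := Submodule.Quotient.mk_surjective _ q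
  obtain ⟨F, x, hFx⟩ := exists_eq_coboundary_add_theta hc
  rw [Submodule.mem_span_range_iff_exists_fun]
  refine ⟨x, ?_⟩
  rw [sum_smul_classOf]
  refine ((Submodule.Quotient.eq _).2 ?_).symm
  exact ⟨F, by rw [eq_comm]; exact sub_eq_of_eq_add hFx⟩

theorem finrank_H1 : Module.finrank 𝕜 (H1 𝕜 (VectS1 𝕜) (PsiD 𝕜)) = 4 := by
  have h := finrank_span_eq_card (linearIndependent_classOf_theta (𝕜 := 𝕜))
  rw [span_classOf_theta, finrank_top, Fintype.card_fin] at h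
  exact h

theorem coeff_theta2_of_lt (X : VectS1 𝕜) {k : ℤ} (hk : -1 < k) : (theta2 𝕜 X).coeff k = 0 := by
  rcases lt_or_ge 0 k with h | h
  · exact coeff_seriesCochain_of_one_le (if_neg (by omega)) X h
  · obtain ⟨s, rfl⟩ : ∃ s : ℕ, k = -s := ⟨k.natAbs, by omega⟩
    rw [theta2, coeff_seriesCochain_neg, if_neg (by omega), zero_smul]

theorem coeff_theta2_neg_one (X : VectS1 𝕜) :
    (theta2 𝕜 X).coeff (-1) = (ddx 𝕜)^[2] (VectS1.coeff 𝕜 X) := by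
  have h := coeff_seriesCochain_neg
    (fun n => if 2 ≤ n then (-1) ^ (n - 1) * (2 * ((n : 𝕜) - 3) / n) else 0) X 1
  rw [Nat.cast_one] at h
  rw [theta2, h]
  norm_num

theorem coeff_theta3_of_lt (X : VectS1 𝕜) {k : ℤ} (hk : -2 < k) : (theta3 𝕜 X).coeff k = 0 := by
  rcases lt_or_ge 0 k with h | h
  · exact coeff_seriesCochain_of_one_le (if_neg (by omega)) X h
  · obtain ⟨s, rfl⟩ : ∃ s : ℕ, k = -s := ⟨k.natAbs, by omega⟩
    rw [theta3, coeff_seriesCochain_neg, if_neg (by omega), zero_smul]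

theorem coeff_theta3_neg_two (X : VectS1 𝕜) :
    (theta3 𝕜 X).coeff (-2) = (ddx 𝕜)^[3] (VectS1.coeff 𝕜 X) := by
  have h := coeff_theta3 X 2 le_rfl
  rw [Nat.cast_ofNat] at h
  rw [h]
  norm_num


end PseudoDiff

end

theorem proposition6p2 (𝕜 : Type*) [RCLike 𝕜] :
    (∃ hθ : ∀ i : Fin 4, PseudoDiff.theta 𝕜 i ∈
        PseudoDiff.oneCocycles 𝕜 (PseudoDiff.VectS1 𝕜) (PseudoDiff.PsiD 𝕜),
      Module.finrank 𝕜
          (PseudoDiff.H1 𝕜 (PseudoDiff.VectS1 𝕜) (PseudoDiff.PsiD 𝕜)) = 4 ∧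
      Submodule.span 𝕜 (Set.range fun i : Fin 4 =>
          PseudoDiff.H1.classOf (PseudoDiff.theta 𝕜 i) (hθ i)) = ⊤) ∧
    ∀ X : PseudoDiff.VectS1 𝕜,
      ((∀ k : ℤ, -1 < k → (PseudoDiff.theta2 𝕜 X).coeff k = 0) ∧
        (PseudoDiff.theta2 𝕜 X).coeff (-1) =
          (PseudoDiff.ddx 𝕜)^[2] (PseudoDiff.VectS1.coeff 𝕜 X)) ∧
      ((∀ k : ℤ, -2 < k → (PseudoDiff.theta3 𝕜 X).coeff k = 0) ∧
        (PseudoDiff.theta3 𝕜 X).coeff (-2) =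
          (PseudoDiff.ddx 𝕜)^[3] (PseudoDiff.VectS1.coeff 𝕜 X)) :=
  ⟨⟨PseudoDiff.theta_mem_oneCocycles, PseudoDiff.finrank_H1, PseudoDiff.span_classOf_theta⟩,
    fun X => ⟨⟨fun _ hk => PseudoDiff.coeff_theta2_of_lt X hk, PseudoDiff.coeff_theta2_neg_one X⟩,
      fun _ hk => PseudoDiff.coeff_theta3_of_lt X hk, PseudoDiff.coeff_theta3_neg_two X⟩⟩
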